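/- Work over $\mathbb{C}$. Let $\mathbb{A}(L)$ be the affine $8$-space with coordinates $L_{123},L_{124},L_{125},L_{126},L_{135},L_{136},L_{245},L_{246}$, and let $\mathbb{A}^{10}$ be the affine space with coordinates $t_1,t_2$ and these eight $L_{ijk}$. Consider the following nine polynomials: \begin{align*} F_{1} &=(us_{1}-p_{1}s_{2}-p_{2}s_{3})-L_{126}(-p_{2}p_{3}+p_{1}p_{4})-L_{136}(p_{1}^{2}+t_{1}p_{2}^{2}+p_{2}u)-L_{245}(2p_{1}p_{3}+2t_{1}p_{2}p_{4}+p_{4}u+p_{2}v)-L_{246}(p_{3}^{2}+t_{1}p_{4}^{2}+p_{4}v),\\ F_{2} &=(vs_{1}-p_{3}s_{2}-p_{4}s_{3})+L_{125}(-p_{2}p_{3}+p_{1}p_{4})+L_{135}(p_{1}^{2}+t_{1}p_{2}^{2}+p_{2}u)+L_{136}(2p_{1}p_{3}+2t_{1}p_{2}p_{4}+p_{4}u+p_{2}v)+L_{245}(p_{3}^{2}+t_{1}p_{4}^{2}+p_{4}v),\\ F_{3} &=(-t_{2}p_{2}s_{1}+(u+t_{1}p_{2})s_{2}-p_{1}s_{3})-L_{124}(-p_{2}p_{3}+p_{1}p_{4})-L_{136}(t_{2}p_{2}^{2}+p_{1}u)-L_{245}(2t_{2}p_{2}p_{4}+p_{3}u+p_{1}v)-L_{246}(t_{2}p_{4}^{2}+p_{3}v),\\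 F_{4} &=(-t_{2}p_{4}s_{1}+(v+t_{1}p_{4})s_{2}-p_{3}s_{3})+L_{123}(-p_{2}p_{3}+p_{1}p_{4})+L_{135}(t_{2}p_{2}^{2}+p_{1}u)+L_{136}(2t_{2}p_{2}p_{4}+p_{3}u+p_{1}v)+L_{245}(t_{2}p_{4}^{2}+p_{3}v),\\ F_{5} &=(-t_{2}p_{1}s_{1}+(t_{1}p_{1}-t_{2}p_{2})s_{2}+(u+t_{1}p_{2})s_{3})+L_{123}(p_{1}^{2}+t_{1}p_{2}^{2}+p_{2}u)+L_{124}(p_{1}p_{3}+t_{1}p_{2}p_{4}+p_{2}v)\\ &\quad-L_{125}(t_{2}p_{2}^{2}+p_{1}u)-L_{126}(t_{2}p_{2}p_{4}+p_{1}v)-L_{136}(t_{1}p_{2}u-t_{2}p_{1}p_{2}+u^{2})\\ &\quad-L_{245}(t_{1}(p_{4}u+p_{2}v)-t_{2}(p_{2}p_{3}+p_{1}p_{4})+2uv)-L_{246}(t_{1}p_{4}v-t_{2}p_{3}p_{4}+v^{2}),\\ F_{6} &=(-t_{2}p_{3}s_{1}+(t_{1}p_{3}-t_{2}p_{4})s_{2}+(v+t_{1}p_{4})s_{3})+L_{123}(t_{1}p_{2}p_{4}+p_{1}p_{3}+p_{4}u)+L_{124}(p_{3}^{2}+t_{1}p_{4}^{2}+p_{4}v)\\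 &\quad-L_{125}(t_{2}p_{2}p_{4}+p_{3}u)-L_{126}(t_{2}p_{4}^{2}+p_{3}v)+L_{135}(t_{1}p_{2}u-t_{2}p_{1}p_{2}+u^{2})\\ &\quad+L_{136}(t_{1}(p_{4}u+p_{2}v)-t_{2}(p_{2}p_{3}+p_{1}p_{4})+2uv)+L_{245}(t_{1}p_{4}v-t_{2}p_{3}p_{4}+v^{2}),\\ F_{7} &=(-s_{2}^{2}+s_{1}s_{3})+(L_{123}p_{2}+L_{124}p_{4})s_{1}-(L_{125}p_{2}+L_{126}p_{4})s_{2}+L_{123}(L_{136}p_{2}^{2}+2L_{245}p_{2}p_{4}+L_{246}p_{4}^{2})\\ &\quad-L_{124}(L_{135}p_{2}^{2}+2L_{136}p_{2}p_{4}+L_{245}p_{4}^{2})-L_{125}(L_{136}p_{1}p_{2}+L_{245}(p_{2}p_{3}+p_{1}p_{4})+L_{246}p_{3}p_{4})\\ &\quad+L_{126}(L_{135}p_{1}p_{2}+L_{136}(p_{2}p_{3}+p_{1}p_{4})+L_{245}p_{3}p_{4})+(L_{135}L_{245}-L_{136}^{2})(-p_{1}^{2}+2up_{2}+t_{1}p_{2}^{2})\\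 &\quad+(L_{135}L_{246}-L_{136}L_{245})(-p_{1}p_{3}+up_{4}+vp_{2}+t_{1}p_{2}p_{4})+(L_{136}L_{246}-L_{245}^{2})(-p_{3}^{2}+2vp_{4}+t_{1}p_{4}^{2}),\\ F_{8} &=(s_{2}s_{3}+t_{1}s_{1}s_{2}-t_{2}s_{1}^{2})+s_{1}(L_{123}p_{1}+L_{124}p_{3})-s_{2}(L_{125}p_{1}+L_{126}p_{3})\\ &\quad+L_{123}(L_{136}p_{1}p_{2}+L_{245}(p_{1}p_{4}+p_{3}p_{2})+L_{246}p_{3}p_{4})-L_{124}(L_{135}p_{1}p_{2}+L_{136}(p_{1}p_{4}+p_{3}p_{2})+L_{245}p_{3}p_{4})\\ &\quad-L_{125}(L_{136}p_{1}^{2}+2L_{245}p_{1}p_{3}+L_{246}p_{3}^{2})+L_{126}(L_{135}p_{1}^{2}+2L_{136}p_{1}p_{3}+L_{245}p_{3}^{2})\\ &\quad+(-L_{136}^{2}+L_{135}L_{245})(2up_{1}+2t_{1}p_{1}p_{2}-t_{2}p_{2}^{2})+(L_{135}L_{246}-L_{136}L_{245})(vp_{1}+up_{3}+t_{1}(p_{1}p_{4}+p_{3}p_{2})-t_{2}p_{2}p_{4})\\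 &\quad+(L_{246}L_{136}-L_{245}^{2})(2vp_{3}+2t_{1}p_{3}p_{4}-t_{2}p_{4}^{2}),\\ F_{9} &=(t_{1}s_{2}^{2}+s_{3}^{2}-s_{1}s_{2}t_{2})+s_{1}(L_{123}u+L_{124}v)-s_{2}(L_{125}u+L_{126}v)+(L_{124}L_{125}-L_{123}L_{126})(-p_{2}p_{3}+p_{1}p_{4})\\ &\quad-L_{123}(L_{246}(p_{3}^{2}+t_{1}p_{4}^{2})+L_{136}(p_{1}^{2}+t_{1}p_{2}^{2})+2L_{245}(p_{1}p_{3}+t_{1}p_{2}p_{4}))\\ &\quad+L_{124}(L_{135}(p_{1}^{2}+t_{1}p_{2}^{2})+2L_{136}(p_{1}p_{3}+t_{1}p_{2}p_{4})+L_{245}(p_{3}^{2}+t_{1}p_{4}^{2}))\\ &\quad+L_{125}t_{2}(L_{246}p_{4}^{2}+L_{136}p_{2}^{2}+2L_{245}p_{2}p_{4})-L_{126}t_{2}(L_{135}p_{2}^{2}+2L_{136}p_{2}p_{4}+L_{245}p_{4}^{2})\\ &\quad+(-L_{136}^{2}+L_{135}L_{245})(u^{2}+2t_{2}p_{1}p_{2})+(L_{135}L_{246}-L_{136}L_{245})(uv+t_{2}(p_{2}p_{3}+p_{1}p_{4}))+(L_{246}L_{136}-L_{245}^{2})(v^{2}+2t_{2}p_{3}p_{4}).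 \end{align*} In the affine space $\mathbb{A}^{19}$ with all nineteen coordinates they define $\Pi^{15}_{\mathbb{A}}$. They are homogeneous of degree two in $p_1,p_2,p_3,p_4,u,v,s_1,s_2,s_3$, so they also define a closed subscheme $$\hat\Pi\subset\mathbb{P}(p_1,p_2,p_3,p_4,u,v,s_1,s_2,s_3)\times\mathbb{A}^{10},$$ the partial projectivization of $\Pi^{15}_{\mathbb{A}}$. Let $\rho_\Pi\colon\hat\Pi\to\mathbb{A}^{10}$ be the projection. Let $b\colon\mathbb{A}(A,B)\times\mathbb{A}(L)\to\mathbb{A}^{10}$ be the morphism given by $t_1=-A^2-AB-B^2$, $t_2=-AB(A+B)$ and the identity on the $L_{ijk}$, and let $U_{AB}=\{(A-B)(2A+B)(A+2B)\neq0\}\subset\mathbb{A}(A,B)$. On $U_{AB}\times\mathbb{A}(L)$ put \begin{align*} p_{111}&=-3L_{246}, & p_{112}&=3L_{245}+\tfrac{3(L_{124}+(A+B)L_{126})}{(2A+B)(A+2B)},\\ p_{121}&=3L_{245}+\tfrac{3(-L_{124}+BL_{126})}{(A-B)(A+2B)}, & p_{122}&=-3L_{136}+\tfrac{3(L_{123}-AL_{125})}{(A-B)(2A+B)},\\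 p_{211}&=3L_{245}+\tfrac{3(L_{124}-AL_{126})}{(A-B)(2A+B)}, & p_{212}&=-3L_{136}+\tfrac{3(-L_{123}+BL_{125})}{(A-B)(A+2B)},\\ p_{221}&=-3L_{136}+\tfrac{3(L_{123}+(A+B)L_{125})}{(2A+B)(A+2B)}, & p_{222}&=3L_{135}, \end{align*} and let \begin{align*} \mathcal{H}={}&p_{111}^{2}p_{222}^{2}+p_{112}^{2}p_{221}^{2}+p_{121}^{2}p_{212}^{2}+p_{122}^{2}p_{211}^{2}-2p_{111}p_{122}p_{211}p_{222}-2p_{111}p_{121}p_{212}p_{222}-2p_{111}p_{112}p_{221}p_{222}\\ &-2p_{121}p_{122}p_{211}p_{212}-2p_{112}p_{122}p_{211}p_{221}-2p_{112}p_{121}p_{212}p_{221}+4p_{111}p_{122}p_{212}p_{221}+4p_{112}p_{121}p_{211}p_{222} \end{align*} be Cayley's hyperdeterminant. Let $\{\mathcal{H}'=0\}\subset\mathbb{A}^{10}$ be the image under $b$ of the subset $\{\mathcal{H}=0\}$ of $U_{AB}\times\mathbb{A}(L)$; it lies in $\{4t_1^3+27t_2^2\neq0\}\times\mathbb{A}(L)=b(U_{AB}\times\mathbb{A}(L))$.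 Finally let $\mathbb{P}^{2,2}\subset\mathbb{P}^8$ be the closed subscheme $\{(S,\sigma)\mid S^{\dagger}=O,\ S\sigma=0\}$, where $S$ is a symmetric $3\times3$ matrix, $\sigma$ is a vector of length three, the six entries of $S$ and the three entries of $\sigma$ are the homogeneous coordinates, and $S^\dagger$ is the adjugate of $S$ (a singular del Pezzo fourfold of degree six, a degeneration of $\mathbb{P}^2\times\mathbb{P}^2$). **Proposition.** (1) The scheme-theoretic fiber of $\rho_\Pi$ over every closed point of $\{4t_1^3+27t_2^2\neq0\}\times\mathbb{A}(L)$ outside $\{\mathcal{H}'=0\}$ is isomorphic over $\mathbb{C}$ to $\mathbb{P}^2\times\mathbb{P}^2$. (2) There is a nonempty subset of $\{\mathcal{H}'=0\}$ such that the fiber of $\rho_\Pi$ over each of its closed points is isomorphic over $\mathbb{C}$ to $\mathbb{P}^{2,2}$. -/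

import Mathlib

open CategoryTheory CategoryTheory.Limits AlgebraicGeometry MvPolynomial

namespace KeyVariety

/-! ### Projective schemes defined by homogeneous equations -/

section GradedQuotient

variable {R A : Type*} [CommRing R] [CommRing A] [Algebra R A]
  (𝒜 : ℕ → Submodule R A) [GradedAlgebra 𝒜] (I : HomogeneousIdeal 𝒜)

/-- The grading of `A ⧸ I` by the images of the graded pieces of `A`. -/
def quotientGrading (n : ℕ) : Submodule R (A ⧸ I.toIdeal) :=
  (𝒜 n).map (Ideal.Quotient.mkₐ R I.toIdeal).toLinearMap

theorem mk_mem_quotientGrading {n : ℕ} {a : A} (ha : a ∈ 𝒜 n) :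
    Ideal.Quotient.mk I.toIdeal a ∈ quotientGrading 𝒜 I n :=
  ⟨a, ha, rfl⟩

instance quotientGrading_gradedMonoid : SetLike.GradedMonoid (quotientGrading 𝒜 I) where
  one_mem := ⟨1, SetLike.GradedOne.one_mem, rfl⟩
  mul_mem := by
    rintro i j _ _ ⟨a, ha, rfl⟩ ⟨b, hb, rfl⟩
    exact ⟨a * b, SetLike.GradedMul.mul_mem ha hb, map_mul (Ideal.Quotient.mkₐ R I.toIdeal) a b⟩

theorem quotientGrading_isInternal : DirectSum.IsInternal (quotientGrading 𝒜 I) := by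
  classical
  let π : A →ₐ[R] A ⧸ I.toIdeal := Ideal.Quotient.mkₐ R I.toIdeal
  let f : ∀ i, 𝒜 i →+ quotientGrading 𝒜 I i := fun i =>
    { toFun := fun a => ⟨π a, ⟨a, a.2, rfl⟩⟩
      map_zero' := Subtype.ext (map_zero π)
      map_add' := fun a b => Subtype.ext (map_add π _ _) }
  have hf : ∀ i, Function.Surjective (f i) := by
    rintro i ⟨_, a, ha, rfl⟩
    exact ⟨⟨a, ha⟩, rfl⟩
  have hcoe : ∀ y : DirectSum ℕ fun i => 𝒜 i,
      DirectSum.coeAddMonoidHom (quotientGrading 𝒜 I) (DirectSum.map f y) =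
        π (DirectSum.coeAddMonoidHom 𝒜 y) := by
    intro y
    induction y using DirectSum.induction_on with
    | zero => simp
    | of i a => simp [f]
    | add a b ha hb => simp only [map_add, ha, hb]
  constructor
  · rw [injective_iff_map_eq_zero]
    intro x hx
    obtain ⟨y, rfl⟩ := (DirectSum.map_surjective f).2 hf x
    rw [hcoe] at hx
    have hy : DirectSum.coeAddMonoidHom 𝒜 y ∈ I.toIdeal := Ideal.Quotient.eq_zero_iff_mem.1 hx
    have hy' : DirectSum.decompose 𝒜 (DirectSum.coeAddMonoidHom 𝒜 y) = y :=
      DirectSum.Decomposition.right_inv y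
    ext i
    have := I.isHomogeneous i hy
    rw [hy'] at this
    have h0 : π (y i) = 0 := Ideal.Quotient.eq_zero_iff_mem.2 this
    simpa [f] using h0
  · intro x
    obtain ⟨a, rfl⟩ := Ideal.Quotient.mk_surjective x
    refine ⟨DirectSum.map f (DirectSum.decompose 𝒜 a), ?_⟩
    rw [hcoe]
    exact congrArg π (DirectSum.Decomposition.left_inv a)

noncomputable instance quotientGrading_gradedAlgebra : GradedAlgebra (quotientGrading 𝒜 I) :=
  DirectSum.IsInternal.gradedAlgebra (quotientGrading_isInternal 𝒜 I)

end GradedQuotient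

section ProjectiveSchemes

attribute [local instance] MvPolynomial.gradedAlgebra

variable {R : Type} [CommRing R] {σ : Type} {ι : Type}

/-- The homogeneous ideal generated by a family of homogeneous polynomials. -/
noncomputable def homogeneousSpan (F : ι → MvPolynomial σ R) (hF : ∀ j, ∃ n, (F j).IsHomogeneous n) :
    HomogeneousIdeal (homogeneousSubmodule σ R) :=
  ⟨Ideal.span (Set.range F), Ideal.homogeneous_span _ _ (by
    rintro _ ⟨j, rfl⟩
    obtain ⟨n, hn⟩ := hF j
    exact ⟨n, (mem_homogeneousSubmodule n (F j)).2 hn⟩)⟩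

/-- The closed subscheme `{F = 0}` of the projective space over `Spec R` with homogeneous
coordinates indexed by `σ`, that is `Proj (R[x] / (F))`. -/
noncomputable def projZeros (F : ι → MvPolynomial σ R) (hF : ∀ j, ∃ n, (F j).IsHomogeneous n) :
    Scheme.{0} :=
  Proj (quotientGrading (homogeneousSubmodule σ R) (homogeneousSpan F hF))

/-- The structure morphism of `{F = 0}` to `Spec R`. -/
noncomputable def projZerosToSpec (F : ι → MvPolynomial σ R)
    (hF : ∀ j, ∃ n, (F j).IsHomogeneous n) : projZeros F hF ⟶ Spec (.of R) :=
  Proj.toSpecZero (quotientGrading (homogeneousSubmodule σ R) (homogeneousSpan F hF)) ≫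
    Spec.map (CommRingCat.ofHom (algebraMap R
      (quotientGrading (homogeneousSubmodule σ R) (homogeneousSpan F hF) 0)))

/-- The complex projective plane `ℙ²`. -/
noncomputable def projectivePlane : Scheme.{0} := Proj (homogeneousSubmodule (Fin 3) ℂ)

/-- The structure morphism of the projective plane. -/
noncomputable def projectivePlaneToSpec : projectivePlane ⟶ Spec (.of ℂ) :=
  Proj.toSpecZero (homogeneousSubmodule (Fin 3) ℂ) ≫
    Spec.map (CommRingCat.ofHom (algebraMap ℂ (homogeneousSubmodule (Fin 3) ℂ 0)))

end ProjectiveSchemes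

/-- `ℙ² × ℙ²` as a scheme over `ℂ`. -/
noncomputable def planeTimesPlane : Over (Spec (.of ℂ)) :=
  Over.mk (pullback.fst projectivePlaneToSpec projectivePlaneToSpec ≫ projectivePlaneToSpec)

/-! ### The singular del Pezzo fourfold `ℙ^{2,2}` -/

/-- The generic symmetric `3 × 3` matrix `S`, whose entries `s_{ij} = s_{ji}` are indexed by
unordered pairs. -/
noncomputable def symMatrix : Matrix (Fin 3) (Fin 3) (MvPolynomial (Sym2 (Fin 3) ⊕ Fin 3) ℂ) :=
  Matrix.of fun i j => X (Sum.inl s(i, j))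

/-- The generic vector `σ` of length three. -/
noncomputable def sigmaVector : Fin 3 → MvPolynomial (Sym2 (Fin 3) ⊕ Fin 3) ℂ :=
  fun i => X (Sum.inr i)

/-- The entries of `S†` and of `S σ`. -/
noncomputable def delPezzoEquation :
    (Fin 3 × Fin 3) ⊕ Fin 3 → MvPolynomial (Sym2 (Fin 3) ⊕ Fin 3) ℂ
  | Sum.inl ij => symMatrix.adjugate ij.1 ij.2
  | Sum.inr i => (symMatrix.mulVec sigmaVector) i

theorem adjugate_isHomogeneous {σ : Type} {M : Matrix (Fin 3) (Fin 3) (MvPolynomial σ ℂ)}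
    (hM : ∀ i j, (M i j).IsHomogeneous 1) (i j : Fin 3) : (M.adjugate i j).IsHomogeneous 2 := by
  rw [Matrix.adjugate_fin_succ_eq_det_submatrix, Matrix.det_fin_two]
  have h1 : ((-1 : MvPolynomial σ ℂ) ^ (j + i : ℕ)).IsHomogeneous 0 := by
    simpa using (isHomogeneous_one σ ℂ).neg.pow (j + i : ℕ)
  have h2 := h1.mul (((hM (j.succAbove 0) (i.succAbove 0)).mul
    (hM (j.succAbove 1) (i.succAbove 1))).sub
    ((hM (j.succAbove 0) (i.succAbove 1)).mul (hM (j.succAbove 1) (i.succAbove 0))))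
  simpa only [Matrix.submatrix_apply] using h2

theorem delPezzoEquation_isHomogeneous (j : (Fin 3 × Fin 3) ⊕ Fin 3) :
    (delPezzoEquation j).IsHomogeneous 2 := by
  have hS : ∀ i j, (symMatrix i j).IsHomogeneous 1 := fun i j => isHomogeneous_X _ _
  have hσ : ∀ i, (sigmaVector i).IsHomogeneous 1 := fun i => isHomogeneous_X _ _
  rcases j with ⟨i, j⟩ | i
  · exact adjugate_isHomogeneous hS i j
  · exact IsHomogeneous.sum _ _ _ fun j _ => (hS i j).mul (hσ j)

/-- `ℙ^{2,2} = {(S, σ) | S† = 0, S σ = 0}` as a scheme over `ℂ`. -/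
noncomputable def degenerateDelPezzo : Over (Spec (.of ℂ)) :=
  Over.mk (projZerosToSpec delPezzoEquation fun j => ⟨2, delPezzoEquation_isHomogeneous j⟩)

/-! ### The family `ρ_Π` -/

/-- The coordinates of `𝔸(L)`. -/
inductive LCoord
  | L123 | L124 | L125 | L126 | L135 | L136 | L245 | L246
  deriving DecidableEq

/-- The coordinates of the base `𝔸¹⁰`. -/
inductive BaseCoord
  | t1 | t2 | L (l : LCoord)
  deriving DecidableEq

/-- The coordinates that are made projective. -/
inductive FiberCoord
  | p1 | p2 | p3 | p4 | u | v | s1 | s2 | s3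
  deriving DecidableEq

/-- The nine polynomials `F₁, …, F₉`, evaluated at nineteen elements of a commutative ring. -/
def nineEquations {S : Type*} [CommRing S]
    (p1 p2 p3 p4 u v t1 t2 L123 L124 L125 L126 L135 L136 L245 L246 s1 s2 s3 : S) : Fin 9 → S :=
  ![(u * s1 - p1 * s2 - p2 * s3) - L126 * (-p2 * p3 + p1 * p4)
      - L136 * (p1 ^ 2 + t1 * p2 ^ 2 + p2 * u)
      - L245 * (2 * p1 * p3 + 2 * t1 * p2 * p4 + p4 * u + p2 * v)
      - L246 * (p3 ^ 2 + t1 * p4 ^ 2 + p4 * v),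
    (v * s1 - p3 * s2 - p4 * s3) + L125 * (-p2 * p3 + p1 * p4)
      + L135 * (p1 ^ 2 + t1 * p2 ^ 2 + p2 * u)
      + L136 * (2 * p1 * p3 + 2 * t1 * p2 * p4 + p4 * u + p2 * v)
      + L245 * (p3 ^ 2 + t1 * p4 ^ 2 + p4 * v),
    (-t2 * p2 * s1 + (u + t1 * p2) * s2 - p1 * s3) - L124 * (-p2 * p3 + p1 * p4)
      - L136 * (t2 * p2 ^ 2 + p1 * u)
      - L245 * (2 * t2 * p2 * p4 + p3 * u + p1 * v)
      - L246 * (t2 * p4 ^ 2 + p3 * v),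
    (-t2 * p4 * s1 + (v + t1 * p4) * s2 - p3 * s3) + L123 * (-p2 * p3 + p1 * p4)
      + L135 * (t2 * p2 ^ 2 + p1 * u)
      + L136 * (2 * t2 * p2 * p4 + p3 * u + p1 * v)
      + L245 * (t2 * p4 ^ 2 + p3 * v),
    (-t2 * p1 * s1 + (t1 * p1 - t2 * p2) * s2 + (u + t1 * p2) * s3)
      + L123 * (p1 ^ 2 + t1 * p2 ^ 2 + p2 * u) + L124 * (p1 * p3 + t1 * p2 * p4 + p2 * v)
      - L125 * (t2 * p2 ^ 2 + p1 * u) - L126 * (t2 * p2 * p4 + p1 * v)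
      - L136 * (t1 * p2 * u - t2 * p1 * p2 + u ^ 2)
      - L245 * (t1 * (p4 * u + p2 * v) - t2 * (p2 * p3 + p1 * p4) + 2 * u * v)
      - L246 * (t1 * p4 * v - t2 * p3 * p4 + v ^ 2),
    (-t2 * p3 * s1 + (t1 * p3 - t2 * p4) * s2 + (v + t1 * p4) * s3)
      + L123 * (t1 * p2 * p4 + p1 * p3 + p4 * u) + L124 * (p3 ^ 2 + t1 * p4 ^ 2 + p4 * v)
      - L125 * (t2 * p2 * p4 + p3 * u) - L126 * (t2 * p4 ^ 2 + p3 * v)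
      + L135 * (t1 * p2 * u - t2 * p1 * p2 + u ^ 2)
      + L136 * (t1 * (p4 * u + p2 * v) - t2 * (p2 * p3 + p1 * p4) + 2 * u * v)
      + L245 * (t1 * p4 * v - t2 * p3 * p4 + v ^ 2),
    (-s2 ^ 2 + s1 * s3) + ((L123 * p2 + L124 * p4) * s1 - (L125 * p2 + L126 * p4) * s2)
      + L123 * (L136 * p2 ^ 2 + 2 * L245 * p2 * p4 + L246 * p4 ^ 2)
      - L124 * (L135 * p2 ^ 2 + 2 * L136 * p2 * p4 + L245 * p4 ^ 2)
      - L125 * (L136 * p1 * p2 + L245 * (p2 * p3 + p1 * p4) + L246 * p3 * p4)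
      + L126 * (L135 * p1 * p2 + L136 * (p2 * p3 + p1 * p4) + L245 * p3 * p4)
      + (L135 * L245 - L136 ^ 2) * (-p1 ^ 2 + 2 * u * p2 + t1 * p2 ^ 2)
      + (L135 * L246 - L136 * L245) * (-p1 * p3 + u * p4 + v * p2 + t1 * p2 * p4)
      + (L136 * L246 - L245 ^ 2) * (-p3 ^ 2 + 2 * v * p4 + t1 * p4 ^ 2),
    (s2 * s3 + t1 * s1 * s2 - t2 * s1 ^ 2) + s1 * (L123 * p1 + L124 * p3)
      - s2 * (L125 * p1 + L126 * p3)
      + L123 * (L136 * p1 * p2 + L245 * (p1 * p4 + p3 * p2) + L246 * p3 * p4)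
      - L124 * (L135 * p1 * p2 + L136 * (p1 * p4 + p3 * p2) + L245 * p3 * p4)
      - L125 * (L136 * p1 ^ 2 + 2 * L245 * p1 * p3 + L246 * p3 ^ 2)
      + L126 * (L135 * p1 ^ 2 + 2 * L136 * p1 * p3 + L245 * p3 ^ 2)
      + (-L136 ^ 2 + L135 * L245) * (2 * u * p1 + 2 * t1 * p1 * p2 - t2 * p2 ^ 2)
      + (L135 * L246 - L136 * L245) *
        ((v * p1 + u * p3) + t1 * (p1 * p4 + p3 * p2) - t2 * p2 * p4)
      + (L246 * L136 - L245 ^ 2) * (2 * v * p3 + 2 * t1 * p3 * p4 - t2 * p4 ^ 2),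
    (t1 * s2 ^ 2 + s3 ^ 2 - s1 * s2 * t2) + s1 * (L123 * u + L124 * v) - s2 * (L125 * u + L126 * v)
      + (L124 * L125 - L123 * L126) * (-p2 * p3 + p1 * p4)
      - L123 * (L246 * (p3 ^ 2 + t1 * p4 ^ 2) + L136 * (p1 ^ 2 + t1 * p2 ^ 2)
        + 2 * L245 * (p1 * p3 + t1 * p2 * p4))
      + L124 * (L135 * (p1 ^ 2 + t1 * p2 ^ 2) + 2 * L136 * (p1 * p3 + t1 * p2 * p4)
        + L245 * (p3 ^ 2 + t1 * p4 ^ 2))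
      + L125 * t2 * (L246 * p4 ^ 2 + L136 * p2 ^ 2 + 2 * L245 * p2 * p4)
      - L126 * t2 * (L135 * p2 ^ 2 + 2 * L136 * p2 * p4 + L245 * p4 ^ 2)
      + (-L136 ^ 2 + L135 * L245) * (u ^ 2 + 2 * t2 * p1 * p2)
      + (L135 * L246 - L136 * L245) * (u * v + t2 * (p2 * p3 + p1 * p4))
      + (L246 * L136 - L245 ^ 2) * (v ^ 2 + 2 * t2 * p3 * p4)]

theorem map_nineEquations {S T : Type*} [CommRing S] [CommRing T] (φ : S →+* T)
    (p1 p2 p3 p4 u v t1 t2 L123 L124 L125 L126 L135 L136 L245 L246 s1 s2 s3 : S) (j : Fin 9) :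
    φ (nineEquations p1 p2 p3 p4 u v t1 t2 L123 L124 L125 L126 L135 L136 L245 L246 s1 s2 s3 j) =
      nineEquations (φ p1) (φ p2) (φ p3) (φ p4) (φ u) (φ v) (φ t1) (φ t2) (φ L123) (φ L124)
        (φ L125) (φ L126) (φ L135) (φ L136) (φ L245) (φ L246) (φ s1) (φ s2) (φ s3) j := by
  fin_cases j <;>
    simp only [nineEquations, Matrix.cons_val, Fin.zero_eta, Fin.mk_one, Fin.reduceFinMk, map_add,
      map_sub, map_mul, map_neg, map_pow, map_ofNat]

theorem nineEquations_smul {S : Type*} [CommRing S]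
    (p1 p2 p3 p4 u v t1 t2 L123 L124 L125 L126 L135 L136 L245 L246 s1 s2 s3 c : S) (j : Fin 9) :
    nineEquations (p1 * c) (p2 * c) (p3 * c) (p4 * c) (u * c) (v * c) t1 t2 L123 L124 L125 L126
        L135 L136 L245 L246 (s1 * c) (s2 * c) (s3 * c) j =
      nineEquations p1 p2 p3 p4 u v t1 t2 L123 L124 L125 L126 L135 L136 L245 L246 s1 s2 s3 j *
        c ^ 2 := by
  fin_cases j <;>
  · simp only [nineEquations, Matrix.cons_val, Fin.zero_eta, Fin.mk_one, Fin.reduceFinMk]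
    ring

/-- The coordinate ring of the base `𝔸¹⁰`. -/
abbrev BaseRing : Type := MvPolynomial BaseCoord ℂ

/-- The nine polynomials `F₁, …, F₉` as polynomials in the projective coordinates, with
coefficients in the coordinate ring of `𝔸¹⁰`. -/
noncomputable def piEquation : Fin 9 → MvPolynomial FiberCoord BaseRing :=
  nineEquations (X .p1) (X .p2) (X .p3) (X .p4) (X .u) (X .v)
    (C (X .t1)) (C (X .t2))
    (C (X (.L .L123))) (C (X (.L .L124))) (C (X (.L .L125))) (C (X (.L .L126)))
    (C (X (.L .L135))) (C (X (.L .L136))) (C (X (.L .L245))) (C (X (.L .L246)))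
    (X .s1) (X .s2) (X .s3)

/-- A polynomial which is multiplied by `T²` under the substitution `x ↦ x T` is homogeneous of
degree two. -/
theorem isHomogeneous_two_of_scaling {R σ : Type} [CommRing R] (p : MvPolynomial σ R)
    (h : MvPolynomial.eval₂Hom ((Polynomial.C : MvPolynomial σ R →+* _).comp MvPolynomial.C)
      (fun i => Polynomial.C (X i) * Polynomial.X) p = Polynomial.C p * Polynomial.X ^ 2) :
    p.IsHomogeneous 2 := by
  have key : ∀ (q : MvPolynomial σ R) (n : ℕ),
      (MvPolynomial.eval₂Hom ((Polynomial.C : MvPolynomial σ R →+* _).comp MvPolynomial.C)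
        (fun i => Polynomial.C (X i) * Polynomial.X) q).coeff n = homogeneousComponent n q := by
    intro q n
    induction q using MvPolynomial.induction_on' with
    | monomial s a =>
      have h1 : MvPolynomial.eval₂Hom
          ((Polynomial.C : MvPolynomial σ R →+* _).comp MvPolynomial.C)
          (fun i => Polynomial.C (X i) * Polynomial.X) (monomial s a) =
          Polynomial.C (monomial s a) * Polynomial.X ^ s.degree := by
        rw [MvPolynomial.eval₂Hom_monomial, MvPolynomial.monomial_eq, Finsupp.degree]
        simp only [Finsupp.prod, mul_pow, Finset.prod_mul_distrib, Finset.prod_pow_eq_pow_sum,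
          map_mul, map_prod, map_pow, RingHom.comp_apply, mul_assoc]
        rfl
      rw [h1, Polynomial.coeff_C_mul_X_pow,
        homogeneousComponent_of_mem (isHomogeneous_monomial a rfl)]
    | add f g hf hg => simp only [map_add, Polynomial.coeff_add, hf, hg]
  have := key p 2
  rw [h, Polynomial.coeff_C_mul_X_pow, if_pos rfl] at this
  rw [this]
  exact homogeneousComponent_isHomogeneous 2 p

theorem piEquation_isHomogeneous (j : Fin 9) : (piEquation j).IsHomogeneous 2 := by
  apply isHomogeneous_two_of_scaling
  rw [piEquation, map_nineEquations, map_nineEquations]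
  simp only [eval₂Hom_X', eval₂Hom_C, RingHom.comp_apply]
  exact nineEquations_smul _ _ _ _ _ _ _ _ _ _ _ _ _ _ _ _ _ _ _ _ j

/-- The partial projectivization `Π̂ ⊆ ℙ⁸ × 𝔸¹⁰`, defined by `F₁ = ⋯ = F₉ = 0`. -/
noncomputable def piHat : Scheme.{0} :=
  projZeros piEquation fun j => ⟨2, piEquation_isHomogeneous j⟩

/-- The projection `ρ_Π : Π̂ ⟶ 𝔸¹⁰`. -/
noncomputable def rhoPi : piHat ⟶ Spec (.of BaseRing) :=
  projZerosToSpec piEquation fun j => ⟨2, piEquation_isHomogeneous j⟩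

/-- The inclusion `Spec ℂ ⟶ 𝔸¹⁰` of the closed point with coordinates `a`. -/
noncomputable def basePoint (a : BaseCoord → ℂ) : Spec (.of ℂ) ⟶ Spec (.of BaseRing) :=
  Spec.map (CommRingCat.ofHom (MvPolynomial.eval a))

/-- The scheme-theoretic fiber of `ρ_Π` over the closed point `a`, as a scheme over `ℂ`. -/
noncomputable def rhoPiFiber (a : BaseCoord → ℂ) : Over (Spec (.of ℂ)) :=
  Over.mk (pullback.snd rhoPi (basePoint a))

/-! ### The hyperdeterminantal locus -/

/-- Cayley's hyperdeterminant of a `2 × 2 × 2` hypermatrix; the indices `1, 2` are written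
`0, 1`. -/
def hyperdeterminant (p : Fin 2 → Fin 2 → Fin 2 → ℂ) : ℂ :=
  p 0 0 0 ^ 2 * p 1 1 1 ^ 2 + p 0 0 1 ^ 2 * p 1 1 0 ^ 2 + p 0 1 0 ^ 2 * p 1 0 1 ^ 2
    + p 0 1 1 ^ 2 * p 1 0 0 ^ 2
    - 2 * p 0 0 0 * p 0 1 1 * p 1 0 0 * p 1 1 1 - 2 * p 0 0 0 * p 0 1 0 * p 1 0 1 * p 1 1 1
    - 2 * p 0 0 0 * p 0 0 1 * p 1 1 0 * p 1 1 1 - 2 * p 0 1 0 * p 0 1 1 * p 1 0 0 * p 1 0 1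
    - 2 * p 0 0 1 * p 0 1 1 * p 1 0 0 * p 1 1 0 - 2 * p 0 0 1 * p 0 1 0 * p 1 0 1 * p 1 1 0
    + 4 * p 0 0 0 * p 0 1 1 * p 1 0 1 * p 1 1 0 + 4 * p 0 0 1 * p 0 1 0 * p 1 0 0 * p 1 1 1

/-- The open subset `U_{AB}` of the plane `𝔸(A, B)`. -/
def planeOpen : Set (ℂ × ℂ) :=
  {AB | (AB.1 - AB.2) * (2 * AB.1 + AB.2) * (AB.1 + 2 * AB.2) ≠ 0}

/-- The sextic cover `b : 𝔸(A, B) × 𝔸(L) → 𝔸¹⁰`. -/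
def sexticCover (x : (ℂ × ℂ) × (LCoord → ℂ)) : BaseCoord → ℂ
  | .t1 => -x.1.1 ^ 2 - x.1.1 * x.1.2 - x.1.2 ^ 2
  | .t2 => -(x.1.1 * x.1.2 * (x.1.1 + x.1.2))
  | .L l => x.2 l

/-- The `𝔸(P)`-component of the isomorphism `U_{AB} × 𝔸(L) ≃ U_{AB} × 𝔸(P)`; it is only used over
`U_{AB}`, where the denominators do not vanish. -/
noncomputable def hypermatrix (x : (ℂ × ℂ) × (LCoord → ℂ)) : Fin 2 → Fin 2 → Fin 2 → ℂ :=
  let A := x.1.1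
  let B := x.1.2
  let L := x.2
  ![![![-3 * L .L246,
        3 * L .L245 + 3 * (L .L124 + (A + B) * L .L126) / ((2 * A + B) * (A + 2 * B))],
      ![3 * L .L245 + 3 * (-L .L124 + B * L .L126) / ((A - B) * (A + 2 * B)),
        -3 * L .L136 + 3 * (L .L123 - A * L .L125) / ((A - B) * (2 * A + B))]],
    ![![3 * L .L245 + 3 * (L .L124 - A * L .L126) / ((A - B) * (2 * A + B)),
        -3 * L .L136 + 3 * (-L .L123 + B * L .L125) / ((A - B) * (A + 2 * B))],
      ![-3 * L .L136 + 3 * (L .L123 + (A + B) * L .L125) / ((2 * A + B) * (A + 2 * B)),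
        3 * L .L135]]]

/-- The locus `{𝓗' = 0}`: the image under `b` of the pull-back to `U_{AB} × 𝔸(L)` of
`U_{AB} × {𝓗 = 0}`. -/
noncomputable def hyperdeterminantalLocus : Set (BaseCoord → ℂ) :=
  sexticCover '' {x | x.1 ∈ planeOpen ∧ hyperdeterminant (hypermatrix x) = 0}

/-- The open subset `{4 t₁³ + 27 t₂² ≠ 0} × 𝔸(L)` of `𝔸¹⁰`. -/
def discriminantOpen : Set (BaseCoord → ℂ) :=
  {a | 4 * a .t1 ^ 3 + 27 * a .t2 ^ 2 ≠ 0}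

end KeyVariety

/-!
# Fibers of `ρ_Π` and Cayley's hyperdeterminant

Over a point with `4 t₁³ + 27 t₂² ≠ 0` the cubic `f = x³ + t₁ x - t₂` has three distinct roots
`θ_i`, namely `A`, `B`, `-A - B`. Evaluating `v - p₃ T - p₄ T²` and `-(u - p₁ T - p₂ T²)` at `θ_i`
gives a vector `x_i` of length two, and evaluating `s₃ + s₂ T + s₁ (T² + t₁)`, up to a correction that is
linear in the `x_j`, gives a scalar `w_i`; these nine linear forms are new coordinates on `ℂ⁹`. The
equations `F₁, F₃, F₅` and `F₂, F₄, F₆` are the coefficients of polynomials of degree two, and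
interpolation at the `θ_i` turns them into the two components of `w_i J x_i + p(·, x_j, x_k) = 0`,
where `p` is the hypermatrix of the base point and `J` a rotation; likewise `F₇, F₈, F₉` become
`w_j w_k + det p(x_i, ·, ·) = 0` modulo the others (`normalForm_inl_zero`, `normalForm_inl_one`,
`normalForm_inr`). So the fiber depends only on `p` (`nonempty_rhoPiFiber_iso_trilinear`).

If the hyperdeterminant of `p` is nonzero, then the pencil spanned by the two slices of `p` has two
singular members, which have rank one, and `p = a₀ ⊗ a₁ ⊗ a₂ + b₀ ⊗ b₁ ⊗ b₂` with `a_i`, `b_i`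
independent (`exists_eq_decomposableHypermatrix`). In the coordinates `a_i · x_i`, `b_i · x_i` and
`w_i` the normal form becomes the ideal of `2 × 2` minors of a generic `3 × 3` matrix
(`nonempty_trilinear_iso_segre`), which defines the Segre embedding of `ℙ² × ℙ²`
(`nonempty_segre_iso`). For the second part, the base points are those where `p` is a general
tangent vector `a ⊗ a ⊗ b + a ⊗ b ⊗ a + b ⊗ a ⊗ a` of the variety of decomposable tensors: there
the hyperdeterminant vanishes and the same coordinates give the equations `S† = 0`, `S σ = 0`
(`nonempty_trilinear_iso_degenerateDelPezzo`).

On the scheme side, a homomorphism from the coordinate ring of a standard chart of `Proj` is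
determined by the scalars and the coordinate functions (`IsGeneratedBy.away_hom_ext`). Together with
a local criterion for cartesian squares (`isPullback_of_openCovers`) this shows that the formation
of `{F = 0}` commutes with base change (`exists_isPullback_projZeros`), so that the
scheme-theoretic fiber is cut out by the specialized equations, and that the two projections of the
Segre variety form a cartesian square.
-/

namespace KeyVariety

/-! ### Charts of `Proj` of an algebra generated in degree one -/

section Charts

open HomogeneousLocalization

theorem eval₂_mul_of_isHomogeneous {R S σ : Type*} [CommSemiring R] [CommSemiring S] (φ : R →+* S)
    (c : S) (v : σ → S) {P : MvPolynomial σ R} {n : ℕ} (hP : P.IsHomogeneous n) :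
    eval₂ φ (fun k => c * v k) P = c ^ n * eval₂ φ v P := by
  rw [eval₂_eq, eval₂_eq, Finset.mul_sum]
  refine Finset.sum_congr rfl fun d hd => ?_
  have hdeg : ∑ i ∈ d.support, d i = n := by
    have := hP (mem_support_iff.1 hd)
    simpa [Finsupp.weight_apply, Finsupp.sum] using this
  simp only [mul_pow, Finset.prod_mul_distrib]
  rw [Finset.prod_pow_eq_pow_sum, hdeg]
  ring

variable {R A : Type} [CommRing R] [CommRing A] [Algebra R A]
  (𝒜 : ℕ → Submodule R A) [GradedAlgebra 𝒜]

/-- The graded `R`-algebra `A` is generated over `R` by the elements `x i` of degree one: its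
homogeneous elements of degree `n` are the values at `x` of the homogeneous polynomials of
degree `n`. -/
structure IsGeneratedBy {σ : Type} (x : σ → A) : Prop where
  mem : ∀ i, x i ∈ 𝒜 1
  exists_eq : ∀ n, ∀ a ∈ 𝒜 n, ∃ P : MvPolynomial σ R, P.IsHomogeneous n ∧ aeval x P = a

/-- The structure map `R → A_(f)` of the coordinate ring of the chart `D₊(f)`. -/
noncomputable def awayScalar (f : A) : R →+* Away 𝒜 f :=
  (fromZeroRingHom 𝒜 _).comp (algebraMap R (𝒜 0))

theorem val_awayScalar (f : A) (r : R) :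
    (awayScalar 𝒜 f r).val = algebraMap A (Localization.Away f) (algebraMap R A r) := by
  rfl

variable {𝒜}

/-- The fraction `a / f` of elements of degree one. -/
noncomputable def ratio {f a : A} (hf : f ∈ 𝒜 1) (ha : a ∈ 𝒜 1) : Away 𝒜 f :=
  Away.mk 𝒜 hf 1 a (by simpa using ha)

theorem algebraMap_mul_val_ratio {f a : A} (hf : f ∈ 𝒜 1) (ha : a ∈ 𝒜 1) :
    algebraMap A (Localization.Away f) f * (ratio hf ha).val =
      algebraMap A (Localization.Away f) a := by
  rw [ratio, Away.val_mk, ← Localization.mk_one_eq_algebraMap, ← Localization.mk_one_eq_algebraMap,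
    Localization.mk_mul, Localization.mk_eq_mk_iff, Localization.r_iff_exists]
  exact ⟨1, by simp⟩

theorem isUnit_algebraMap_away (f : A) : IsUnit (algebraMap A (Localization.Away f) f) :=
  IsLocalization.Away.algebraMap_isUnit f

theorem ratio_self {f : A} (hf : f ∈ 𝒜 1) : ratio hf hf = 1 := by
  apply HomogeneousLocalization.val_injective
  apply (isUnit_algebraMap_away f).mul_left_cancel
  rw [algebraMap_mul_val_ratio, val_one, mul_one]

theorem ratio_congr {f a b : A} (hf : f ∈ 𝒜 1) (ha : a ∈ 𝒜 1) (hb : b ∈ 𝒜 1) (h : a = b) :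
    ratio hf ha = ratio hf hb := by
  subst h; rfl

theorem eval₂_ratio {σ : Type} {x : σ → A} (hx : ∀ i, x i ∈ 𝒜 1) {f : A} (hf : f ∈ 𝒜 1)
    {P : MvPolynomial σ R} {n : ℕ} (hP : P.IsHomogeneous n) (ha : aeval x P ∈ 𝒜 (n • 1)) :
    eval₂ (awayScalar 𝒜 f) (fun k => ratio hf (hx k)) P = Away.mk 𝒜 hf n (aeval x P) ha := by
  apply HomogeneousLocalization.val_injective
  apply ((isUnit_algebraMap_away f).pow n).mul_left_cancel
  have h1 : (eval₂ (awayScalar 𝒜 f) (fun k => ratio hf (hx k)) P).val =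
      eval₂ ((algebraMap A (Localization.Away f)).comp (algebraMap R A))
        (fun k => (ratio hf (hx k)).val) P := by
    change algebraMap (Away 𝒜 f) (Localization.Away f) _ = _
    rw [hom_eval₂]
    rfl
  rw [h1, ← eval₂_mul_of_isHomogeneous _ _ _ hP]
  simp only [algebraMap_mul_val_ratio]
  rw [Away.val_mk, ← map_pow, ← Localization.mk_one_eq_algebraMap, Localization.mk_mul]
  rw [show eval₂ ((algebraMap A (Localization.Away f)).comp (algebraMap R A))
      (fun k => algebraMap A (Localization.Away f) (x k)) P =
      algebraMap A (Localization.Away f) (aeval x P) by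
    rw [aeval_def, hom_eval₂]]
  rw [← Localization.mk_one_eq_algebraMap, Localization.mk_eq_mk_iff, Localization.r_iff_exists]
  exact ⟨1, by simp⟩

/-- A ring homomorphism out of the coordinate ring of a chart is determined by the images of the
scalars and of the coordinate functions. -/
theorem IsGeneratedBy.away_hom_ext {σ : Type} {x : σ → A} (hx : IsGeneratedBy 𝒜 x) {f : A}
    (hf : f ∈ 𝒜 1) {T : Type*} [CommRing T] {g h : Away 𝒜 f →+* T}
    (hR : g.comp (awayScalar 𝒜 f) = h.comp (awayScalar 𝒜 f))
    (hk : ∀ k, g (ratio hf (hx.mem k)) = h (ratio hf (hx.mem k))) : g = h := by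
  ext z
  obtain ⟨n, a, ha, rfl⟩ := Away.mk_surjective 𝒜 hf z
  obtain ⟨P, hP, rfl⟩ := hx.exists_eq _ a ha
  have hP' : P.IsHomogeneous n := by simpa using hP
  rw [← eval₂_ratio hx.mem hf hP' ha, hom_eval₂, hom_eval₂, hR]
  simp only [hk]

/-- The homomorphism `A_(f) → T` induced by a homomorphism `A → T` that makes `f` invertible. -/
noncomputable def awayHom {T : Type*} [CommRing T] (Φ : A →+* T) (f : A) (hu : IsUnit (Φ f)) :
    Away 𝒜 f →+* T :=
  (Localization.awayLift Φ f hu).comp (algebraMap (Away 𝒜 f) (Localization.Away f))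

section awayHom

variable {T : Type*} [CommRing T] (Φ : A →+* T) (f : A) (hu : IsUnit (Φ f))

theorem awayHom_comp_awayScalar :
    (awayHom (𝒜 := 𝒜) Φ f hu).comp (awayScalar 𝒜 f) = Φ.comp (algebraMap R A) := by
  ext r
  change Localization.awayLift Φ f hu (awayScalar 𝒜 f r).val = _
  rw [val_awayScalar, Localization.awayLift, IsLocalization.Away.lift_eq]
  rfl

theorem mul_awayHom_ratio (hf : f ∈ 𝒜 1) {a : A} (ha : a ∈ 𝒜 1) :
    Φ f * awayHom (𝒜 := 𝒜) Φ f hu (ratio hf ha) = Φ a := by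
  change Φ f * Localization.awayLift Φ f hu (ratio hf ha).val = _
  have h1 := congrArg (Localization.awayLift Φ f hu) (algebraMap_mul_val_ratio hf ha)
  rw [map_mul, Localization.awayLift, IsLocalization.Away.lift_eq,
    IsLocalization.Away.lift_eq] at h1
  exact h1

theorem awayHom_ratio_of_eq_one (hf : f ∈ 𝒜 1) {a : A} (ha : a ∈ 𝒜 1) (h1 : Φ f = 1) :
    awayHom (𝒜 := 𝒜) Φ f hu (ratio hf ha) = Φ a := by
  rw [← mul_awayHom_ratio Φ f hu hf ha, h1, one_mul]

theorem awayHom_mul_comp_awayMap {g : A} {e : ℕ} (hg : g ∈ 𝒜 e) (hv : IsUnit (Φ (f * g))) :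
    (awayHom (𝒜 := 𝒜) Φ (f * g) hv).comp (awayMap 𝒜 hg rfl) = awayHom Φ f hu := by
  ext z
  change Localization.awayLift Φ (f * g) hv (awayMap 𝒜 hg rfl z).val =
    Localization.awayLift Φ f hu z.val
  rw [val_awayMap]
  rw [← RingHom.comp_apply]
  congr 1
  apply IsLocalization.ringHom_ext (Submonoid.powers f)
  ext a
  simp [Localization.awayLift, IsLocalization.Away.lift_eq]

end awayHom

end Charts

/-! ### `Proj` over the base ring, and cartesian squares of schemes -/

section ProjOver

open HomogeneousLocalization

variable {R A : Type} [CommRing R] [CommRing A] [Algebra R A]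
  (𝒜 : ℕ → Submodule R A) [GradedAlgebra 𝒜]

/-- The structure morphism of `Proj A` to `Spec R`, for a graded `R`-algebra `A`. -/
noncomputable def projToSpec : Proj 𝒜 ⟶ Spec (.of R) :=
  Proj.toSpecZero 𝒜 ≫ Spec.map (CommRingCat.ofHom (algebraMap R (𝒜 0)))

theorem awayι_projToSpec {f : A} {m : ℕ} (hf : f ∈ 𝒜 m) (hm : 0 < m) :
    Proj.awayι 𝒜 f hf hm ≫ projToSpec 𝒜 = Spec.map (CommRingCat.ofHom (awayScalar 𝒜 f)) := by
  rw [projToSpec, Proj.awayι_toSpecZero_assoc, ← Spec.map_comp, ← CommRingCat.ofHom_comp]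
  rfl

variable {𝒜}

theorem SpecMap_awayHom_mul_awayι {T : Type} [CommRing T] (Φ : A →+* T) {f g : A} {d e : ℕ}
    (hf : f ∈ 𝒜 d) (hd : 0 < d) (hg : g ∈ 𝒜 e) (hu : IsUnit (Φ f)) (hv : IsUnit (Φ (f * g))) :
    Spec.map (CommRingCat.ofHom (awayHom (𝒜 := 𝒜) Φ f hu)) ≫ Proj.awayι 𝒜 f hf hd =
      Spec.map (CommRingCat.ofHom (awayHom (𝒜 := 𝒜) Φ (f * g) hv)) ≫
        Proj.awayι 𝒜 (f * g) (SetLike.mul_mem_graded hf hg) (Nat.add_pos_left hd e) := by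
  rw [← awayHom_mul_comp_awayMap Φ f hu hg hv, CommRingCat.ofHom_comp, Spec.map_comp,
    Category.assoc, Proj.SpecMap_awayMap_awayι]

/-- A homomorphism `A → T` that makes both `f` and `g` invertible defines the same `T`-valued
point of `Proj A` on either chart. -/
theorem SpecMap_awayHom_awayι {T : Type} [CommRing T] (Φ : A →+* T) {f g : A} {d e : ℕ}
    (hf : f ∈ 𝒜 d) (hd : 0 < d) (hg : g ∈ 𝒜 e) (he : 0 < e) (hu : IsUnit (Φ f))
    (hv : IsUnit (Φ g)) :
    Spec.map (CommRingCat.ofHom (awayHom (𝒜 := 𝒜) Φ f hu)) ≫ Proj.awayι 𝒜 f hf hd =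
      Spec.map (CommRingCat.ofHom (awayHom (𝒜 := 𝒜) Φ g hv)) ≫ Proj.awayι 𝒜 g hg he := by
  have huv : IsUnit (Φ (f * g)) := by rw [map_mul]; exact hu.mul hv
  have hvu : IsUnit (Φ (g * f)) := by rw [map_mul]; exact hv.mul hu
  rw [SpecMap_awayHom_mul_awayι Φ hf hd hg hu huv, SpecMap_awayHom_mul_awayι Φ hg he hf hv hvu]
  have key : ∀ (a b : A) (m n : ℕ) (h : a = b) (k : m = n) (ha : a ∈ 𝒜 m) (hm : 0 < m)
      (hb : b ∈ 𝒜 n) (hn : 0 < n) (ua : IsUnit (Φ a)) (ub : IsUnit (Φ b)),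
      Spec.map (CommRingCat.ofHom (awayHom (𝒜 := 𝒜) Φ a ua)) ≫ Proj.awayι 𝒜 a ha hm =
        Spec.map (CommRingCat.ofHom (awayHom (𝒜 := 𝒜) Φ b ub)) ≫ Proj.awayι 𝒜 b hb hn := by
    rintro a _ m _ rfl rfl _ _ _ _ _ _
    rfl
  exact key _ _ _ _ (mul_comm f g) (add_comm d e) _ _ _ _ _ _

/-- The generators of degree one generate the irrelevant ideal, so that their charts cover
`Proj A`. -/
theorem IsGeneratedBy.irrelevant_le {σ : Type} {x : σ → A} (hx : IsGeneratedBy 𝒜 x) :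
    (HomogeneousIdeal.irrelevant 𝒜).toIdeal ≤ Ideal.span (Set.range x) := by
  rw [HomogeneousIdeal.toIdeal_irrelevant_le]
  intro n hn a ha
  obtain ⟨P, hP, rfl⟩ := hx.exists_eq n a ha
  rw [aeval_def, eval₂_eq]
  refine Ideal.sum_mem _ fun d hd => Ideal.mul_mem_left _ _ ?_
  have hd0 : d ≠ 0 := by
    rintro rfl
    have := hP (mem_support_iff.1 hd)
    rw [map_zero] at this
    omega
  obtain ⟨i, hi⟩ : d.support.Nonempty := Finsupp.support_nonempty_iff.2 hd0
  refine Ideal.mem_of_dvd _ (Finset.dvd_prod_of_mem _ hi) ?_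
  exact Ideal.pow_mem_of_mem _ (Ideal.subset_span (Set.mem_range_self i)) _
    (Nat.pos_of_ne_zero (Finsupp.mem_support_iff.1 hi))

/-- The affine open cover of `Proj A` by the charts at the generators of degree one. -/
noncomputable def IsGeneratedBy.cover {σ : Type} {x : σ → A} (hx : IsGeneratedBy 𝒜 x) :
    (Proj 𝒜).AffineOpenCover :=
  Proj.affineOpenCoverOfIrrelevantLESpan 𝒜 x hx.mem (fun _ => Nat.one_pos) hx.irrelevant_le

end ProjOver

/-- A commutative square of schemes is cartesian if it is so over the pieces of open covers of
the two factors. -/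
theorem isPullback_of_openCovers {X P Q S : Scheme.{0}} {p : X ⟶ P} {q : X ⟶ Q} {f : P ⟶ S}
    {g : Q ⟶ S} (w : p ≫ f = q ≫ g) (𝒰 : P.OpenCover) (𝒱 : Q.OpenCover)
    {C : 𝒰.I₀ → 𝒱.I₀ → Scheme.{0}} (c : ∀ i j, C i j ⟶ X) (ho : ∀ i j, IsOpenImmersion (c i j))
    (a : ∀ i j, C i j ⟶ 𝒰.X i) (b : ∀ i j, C i j ⟶ 𝒱.X j)
    (ha : ∀ i j, a i j ≫ 𝒰.f i = c i j ≫ p) (hb : ∀ i j, b i j ≫ 𝒱.f j = c i j ≫ q)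
    (hc : ∀ i j, IsPullback (a i j) (b i j) (𝒰.f i ≫ f) (𝒱.f j ≫ g))
    (hr : ∀ i j, p ⁻¹ᵁ (𝒰.f i).opensRange ⊓ q ⁻¹ᵁ (𝒱.f j).opensRange ≤ (c i j).opensRange) :
    IsPullback p q f g := by
  suffices IsIso (pullback.lift p q w) from
    .of_iso_pullback ⟨w⟩ (asIso (pullback.lift p q w)) (pullback.lift_fst _ _ _)
      (pullback.lift_snd _ _ _)
  refine (MorphismProperty.isomorphisms.iff _).1
    (IsZariskiLocalAtTarget.of_openCover (Scheme.Pullback.openCoverOfLeftRight 𝒰 𝒱 f g) ?_)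
  rintro ⟨i, j⟩
  have := ho i j
  let e : pullback (𝒰.f i ≫ f) (𝒱.f j ≫ g) ⟶ pullback f g :=
    pullback.map (𝒰.f i ≫ f) (𝒱.f j ≫ g) f g (𝒰.f i) (𝒱.f j) (𝟙 _)
      (Category.comp_id _) (Category.comp_id _)
  have he : IsOpenImmersion e :=
    (Scheme.Pullback.openCoverOfLeftRight 𝒰 𝒱 f g).map_prop (i, j)
  have hh : c i j ≫ pullback.lift p q w = (hc i j).isoPullback.hom ≫ e := by
    apply pullback.hom_ext
    · rw [Category.assoc, pullback.lift_fst, Category.assoc, pullback.lift_fst,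
        IsPullback.isoPullback_hom_fst_assoc, ha]
    · rw [Category.assoc, pullback.lift_snd, Category.assoc, pullback.lift_snd,
        IsPullback.isoPullback_hom_snd_assoc, hb]
  have hpb : IsPullback (hc i j).isoPullback.hom (c i j) e (pullback.lift p q w) := by
    refine IsOpenImmersion.isPullback _ _ _ _ hh (le_antisymm (le_trans ?_ (hr i j)) ?_)
    · intro z hz
      have hz' : pullback.lift p q w z ∈ Set.range e := hz
      rw [Scheme.Pullback.range_map] at hz'
      refine ⟨?_, ?_⟩
      · have := hz'.1
        rwa [Set.mem_preimage, ← Scheme.Hom.comp_apply, pullback.lift_fst] at this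
      · have := hz'.2
        rwa [Set.mem_preimage, ← Scheme.Hom.comp_apply, pullback.lift_snd] at this
    · rintro _ ⟨z, rfl⟩
      refine ⟨(hc i j).isoPullback.hom z, ?_⟩
      rw [← Scheme.Hom.comp_apply, ← Scheme.Hom.comp_apply, hh]
  have hs : pullback.snd (pullback.lift p q w) e =
      hpb.flip.isoPullback.inv ≫ (hc i j).isoPullback.hom := by
    rw [Iso.eq_inv_comp]
    exact hpb.flip.isoPullback_hom_snd
  have hi : IsIso (pullback.snd (pullback.lift p q w) e) := by
    rw [hs]
    infer_instance
  exact (MorphismProperty.isomorphisms.iff _).2 hi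

/-- A square of affine schemes is cartesian if the square of rings has the universal property of a
pushout with respect to rings. -/
theorem isPullback_SpecMap {R A B C : Type} [CommRing R] [CommRing A] [CommRing B] [CommRing C]
    {f : R →+* A} {g : R →+* B} {a : A →+* C} {b : B →+* C} (w : a.comp f = b.comp g)
    (hex : ∀ (T : Type) [CommRing T] (φ : A →+* T) (ψ : B →+* T), φ.comp f = ψ.comp g →
      ∃ χ : C →+* T, χ.comp a = φ ∧ χ.comp b = ψ)
    (hun : ∀ (T : Type) [CommRing T] (χ χ' : C →+* T), χ.comp a = χ'.comp a →
      χ.comp b = χ'.comp b → χ = χ') :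
    IsPullback (Spec.map (CommRingCat.ofHom a)) (Spec.map (CommRingCat.ofHom b))
      (Spec.map (CommRingCat.ofHom f)) (Spec.map (CommRingCat.ofHom g)) := by
  apply isPullback_SpecMap_of_isPushout
  have w' : CommRingCat.ofHom f ≫ CommRingCat.ofHom a =
      CommRingCat.ofHom g ≫ CommRingCat.ofHom b := by
    rw [← CommRingCat.ofHom_comp, ← CommRingCat.ofHom_comp, w]
  refine ⟨⟨w'⟩, ⟨PushoutCocone.IsColimit.mk w' (fun s => CommRingCat.ofHom
    (hex s.pt s.inl.hom s.inr.hom (congrArg CommRingCat.Hom.hom s.condition)).choose) ?_ ?_ ?_⟩⟩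
  · intro s
    ext1
    exact (hex s.pt s.inl.hom s.inr.hom
      (congrArg CommRingCat.Hom.hom s.condition)).choose_spec.1
  · intro s
    ext1
    exact (hex s.pt s.inl.hom s.inr.hom
      (congrArg CommRingCat.Hom.hom s.condition)).choose_spec.2
  · intro s m h1 h2
    have hs := (hex s.pt s.inl.hom s.inr.hom
      (congrArg CommRingCat.Hom.hom s.condition)).choose_spec
    ext1
    exact hun _ _ _ ((congrArg CommRingCat.Hom.hom h1).trans hs.1.symm)
      ((congrArg CommRingCat.Hom.hom h2).trans hs.2.symm)

/-! ### Functoriality and base change of `{F = 0}` -/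

section GradedMaps

open HomogeneousLocalization

open scoped Graded

variable {R S A B : Type} [CommRing R] [CommRing S] [CommRing A] [CommRing B] [Algebra R A]
  [Algebra S B] {𝒜 : ℕ → Submodule R A} [GradedAlgebra 𝒜] {ℬ : ℕ → Submodule S B}
  [GradedAlgebra ℬ]

theorem awayMap_comp_awayScalar (g : 𝒜 →+*ᵍ ℬ) (φ : R →+* S)
    (hg : ∀ r, g (algebraMap R A r) = algebraMap S B (φ r)) (f : A) :
    (Away.map g f).comp (awayScalar 𝒜 f) = (awayScalar ℬ (g f)).comp φ := by
  ext r
  have h1 : awayScalar 𝒜 f r = HomogeneousLocalization.mk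
      ⟨0, ⟨algebraMap R A r, (algebraMap R (𝒜 0) r).2⟩, 1, one_mem _⟩ := rfl
  rw [RingHom.comp_apply, h1, Away.map, HomogeneousLocalization.map_mk,
    HomogeneousLocalization.val_mk, RingHom.comp_apply, val_awayScalar, ← hg,
    ← Localization.mk_one_eq_algebraMap]
  congr 1
  exact Subtype.ext (map_one g)

theorem awayMap_ratio (g : 𝒜 →+*ᵍ ℬ) {f a : A} (hf : f ∈ 𝒜 1) (ha : a ∈ 𝒜 1) :
    Away.map g f (ratio hf ha) = ratio (Graded.map_mem g hf) (Graded.map_mem g ha) := by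
  rw [ratio, Away.map_mk]
  rfl

theorem map_comp_projToSpec (g : 𝒜 →+*ᵍ ℬ)
    (hirr : HomogeneousIdeal.irrelevant ℬ ≤ (HomogeneousIdeal.irrelevant 𝒜).map g) (φ : R →+* S)
    (hg : ∀ r, g (algebraMap R A r) = algebraMap S B (φ r)) :
    Proj.map g hirr ≫ projToSpec 𝒜 = projToSpec ℬ ≫ Spec.map (CommRingCat.ofHom φ) := by
  have key : ∀ (i : ℕ) (hi : 0 < i) (s : A) (hs : s ∈ 𝒜 i),
      Proj.awayι ℬ (g s) (Graded.map_mem g hs) hi ≫ Proj.map g hirr ≫ projToSpec 𝒜 =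
        Proj.awayι ℬ (g s) (Graded.map_mem g hs) hi ≫
          projToSpec ℬ ≫ Spec.map (CommRingCat.ofHom φ) := by
    intro i hi s hs
    rw [Proj.awayι_comp_map_assoc _ _ hi _ hs, awayι_projToSpec,
      ← Category.assoc (Proj.awayι ℬ _ _ _), awayι_projToSpec, ← Spec.map_comp, ← Spec.map_comp,
      ← CommRingCat.ofHom_comp, ← CommRingCat.ofHom_comp, awayMap_comp_awayScalar g φ hg]
  exact (Proj.mapAffineOpenCover g hirr).openCover.hom_ext _ _ fun s =>
    key s.1 s.1.2 s.2 s.2.2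

theorem irrelevant_le_of_isGeneratedBy {σ : Type} (g : 𝒜 →+*ᵍ ℬ) {x : σ → A}
    (hx : ∀ i, x i ∈ 𝒜 1) (hy : IsGeneratedBy ℬ fun i => g (x i)) :
    HomogeneousIdeal.irrelevant ℬ ≤ (HomogeneousIdeal.irrelevant 𝒜).map g := by
  change (HomogeneousIdeal.irrelevant ℬ).toIdeal ≤
    ((HomogeneousIdeal.irrelevant 𝒜).map g).toIdeal
  refine hy.irrelevant_le.trans ?_
  rw [Ideal.span_le]
  rintro _ ⟨i, rfl⟩
  exact Ideal.mem_map_of_mem _ (HomogeneousIdeal.mem_irrelevant_of_mem _ Nat.one_pos (hx i))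

theorem eval₂_ratio_eq_zero {σ : Type} {x : σ → A} (hx : ∀ i, x i ∈ 𝒜 1) {f : A} (hf : f ∈ 𝒜 1)
    {P : MvPolynomial σ R} {n : ℕ} (hP : P.IsHomogeneous n) (h0 : aeval x P = 0) :
    eval₂ (awayScalar 𝒜 f) (fun k => ratio hf (hx k)) P = 0 := by
  rw [eval₂_ratio hx hf hP (by rw [h0]; exact zero_mem _)]
  exact HomogeneousLocalization.mk_eq_zero_of_num _ (Subtype.ext h0)

end GradedMaps

section CoordinateRings

attribute [local instance] MvPolynomial.gradedAlgebra

variable {R : Type} [CommRing R] {σ ι : Type}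

theorem X_mem (i : σ) : (X i : MvPolynomial σ R) ∈ homogeneousSubmodule σ R 1 :=
  (mem_homogeneousSubmodule 1 _).2 (isHomogeneous_X R i)

theorem isGeneratedBy_X : IsGeneratedBy (homogeneousSubmodule σ R) X where
  mem := X_mem
  exists_eq n a ha := ⟨a, ha, by simp⟩

variable (F : ι → MvPolynomial σ R) (hF : ∀ j, ∃ n, (F j).IsHomogeneous n)

/-- The homogeneous coordinate ring `R[x] / (F)` of the closed subscheme `{F = 0}`. -/
noncomputable abbrev CoordRing : Type := MvPolynomial σ R ⧸ (homogeneousSpan F hF).toIdeal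

/-- The grading of the homogeneous coordinate ring. -/
noncomputable abbrev coordGrading : ℕ → Submodule R (CoordRing F hF) :=
  quotientGrading (homogeneousSubmodule σ R) (homogeneousSpan F hF)

/-- The class of the variable `x i` in the homogeneous coordinate ring. -/
noncomputable def coord (i : σ) : CoordRing F hF := Ideal.Quotient.mk _ (X i)

theorem aeval_coord (P : MvPolynomial σ R) :
    aeval (coord F hF) P = Ideal.Quotient.mk (homogeneousSpan F hF).toIdeal P := by
  have : aeval (coord F hF) = Ideal.Quotient.mkₐ R (homogeneousSpan F hF).toIdeal := by
    ext i
    simp [coord]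
  rw [this]
  rfl

theorem isGeneratedBy_coord : IsGeneratedBy (coordGrading F hF) (coord F hF) where
  mem i := mk_mem_quotientGrading _ _ (isHomogeneous_X R i)
  exists_eq n a ha := by
    obtain ⟨P, hP, rfl⟩ := ha
    exact ⟨P, hP, aeval_coord F hF P⟩

theorem aeval_coord_eq_zero (j : ι) : aeval (coord F hF) (F j) = 0 := by
  rw [aeval_coord, Ideal.Quotient.eq_zero_iff_mem]
  exact Ideal.subset_span (Set.mem_range_self j)

variable {F hF} in
/-- A solution of the equations `F = 0` in an `R`-algebra defines a homomorphism out of the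
homogeneous coordinate ring. -/
noncomputable def coordHom {T : Type*} [CommRing T] (ψ : R →+* T) (v : σ → T)
    (h : ∀ j, eval₂ ψ v (F j) = 0) : CoordRing F hF →+* T :=
  Ideal.Quotient.lift _ (eval₂Hom ψ v) (by
    intro a ha
    change a ∈ Ideal.span (Set.range F) at ha
    have : Ideal.span (Set.range F) ≤ RingHom.ker (eval₂Hom ψ v) := by
      rw [Ideal.span_le]
      rintro _ ⟨j, rfl⟩
      exact h j
    exact this ha)

section coordHom

variable {T : Type*} [CommRing T] (ψ : R →+* T) (v : σ → T) (h : ∀ j, eval₂ ψ v (F j) = 0)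

theorem coordHom_coord (i : σ) : coordHom (hF := hF) ψ v h (coord F hF i) = v i := by
  rw [coord, coordHom, Ideal.Quotient.lift_mk, coe_eval₂Hom, eval₂_X]

theorem coordHom_comp_algebraMap :
    (coordHom (hF := hF) ψ v h).comp (algebraMap R (CoordRing F hF)) = ψ := by
  ext r
  change coordHom (hF := hF) ψ v h (Ideal.Quotient.mk _ (C r)) = _
  rw [coordHom, Ideal.Quotient.lift_mk, coe_eval₂Hom, eval₂_C]

end coordHom

open scoped Graded

variable {S τ κ : Type} [CommRing S] (G : κ → MvPolynomial τ S)
  (hG : ∀ j, ∃ n, (G j).IsHomogeneous n)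

/-- The homomorphism of homogeneous coordinate rings induced by a homomorphism of polynomial rings
that preserves degrees and maps the equations `F` into the ideal generated by the equations `G`. -/
noncomputable def coordMap (φ : MvPolynomial σ R →+* MvPolynomial τ S)
    (hφ : ∀ n P, P.IsHomogeneous n → (φ P).IsHomogeneous n)
    (h : ∀ j, φ (F j) ∈ Ideal.span (Set.range G)) :
    coordGrading F hF →+*ᵍ coordGrading G hG where
  __ := Ideal.quotientMap (homogeneousSpan G hG).toIdeal φ (by
    change Ideal.span (Set.range F) ≤ _
    rw [Ideal.span_le]
    rintro _ ⟨j, rfl⟩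
    exact h j)
  map_mem := by
    rintro n _ ⟨P, hP, rfl⟩
    exact ⟨φ P, hφ n P hP, rfl⟩

end CoordinateRings

section BaseChange

attribute [local instance] MvPolynomial.gradedAlgebra

open HomogeneousLocalization

variable {R S : Type} [CommRing R] [CommRing S] {σ ι : Type}
  (F : ι → MvPolynomial σ R) (hF : ∀ j, ∃ n, (F j).IsHomogeneous n) (φ : R →+* S)
  (hG : ∀ j, ∃ n, (MvPolynomial.map φ (F j)).IsHomogeneous n)

/-- The formation of `{F = 0}` commutes with base change. -/
theorem exists_isPullback_projZeros :
    ∃ p : projZeros (fun j => MvPolynomial.map φ (F j)) hG ⟶ projZeros F hF,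
      IsPullback p (projZerosToSpec _ hG) (projZerosToSpec F hF)
        (Spec.map (CommRingCat.ofHom φ)) := by
  let G := fun j => MvPolynomial.map φ (F j)
  let g := coordMap F hF G hG (MvPolynomial.map φ) (fun n P hP => hP.map φ)
    (fun j => Ideal.subset_span (Set.mem_range_self j))
  have hgc : ∀ i, g (coord F hF i) = coord G hG i := by
    intro i
    change Ideal.Quotient.mk _ (MvPolynomial.map φ (X i)) = _
    rw [MvPolynomial.map_X]
    rfl
  have hgR : ∀ r, g (algebraMap R (CoordRing F hF) r) = algebraMap S (CoordRing G hG) (φ r) := by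
    intro r
    change Ideal.Quotient.mk _ (MvPolynomial.map φ (C r)) = _
    rw [MvPolynomial.map_C]
    rfl
  have hx := isGeneratedBy_coord F hF
  have hy : IsGeneratedBy (coordGrading G hG) (fun i => g (coord F hF i)) := by
    simp only [hgc]
    exact isGeneratedBy_coord G hG
  have hirr := irrelevant_le_of_isGeneratedBy g hx.mem hy
  have ho : ∀ i, IsOpenImmersion
      (Proj.awayι (coordGrading G hG) (g (coord F hF i)) (hy.mem i) Nat.one_pos) :=
    fun _ => inferInstance
  have hsq : ∀ i, IsPullback (Spec.map (CommRingCat.ofHom (Away.map g (coord F hF i))))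
      (Spec.map (CommRingCat.ofHom (awayScalar _ (g (coord F hF i)))))
      (Proj.awayι (coordGrading F hF) (coord F hF i) (hx.mem i) Nat.one_pos ≫
        projToSpec (coordGrading F hF))
      (𝟙 (Spec (.of S)) ≫ Spec.map (CommRingCat.ofHom φ)) := by
    intro i
    rw [awayι_projToSpec, Category.id_comp]
    apply isPullback_SpecMap (awayMap_comp_awayScalar g φ hgR _)
    · intro T _ α ψ hαψ
      have h0 : ∀ j, eval₂ ψ (fun k => α (ratio (hx.mem i) (hx.mem k))) (G j) = 0 := by
        intro j
        obtain ⟨n, hn⟩ := hF j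
        change eval₂ ψ _ (MvPolynomial.map φ (F j)) = 0
        rw [eval₂_map, ← hαψ, ← hom_eval₂,
          eval₂_ratio_eq_zero hx.mem (hx.mem i) hn (aeval_coord_eq_zero F hF j), map_zero]
      have h1 : ∀ k, coordHom (hF := hG) ψ _ h0 (g (coord F hF k)) =
          α (ratio (hx.mem i) (hx.mem k)) := fun k => by rw [hgc, coordHom_coord]
      have h2 : coordHom (hF := hG) ψ _ h0 (g (coord F hF i)) = 1 := by
        rw [h1, ratio_self, map_one]
      have hs := awayHom_comp_awayScalar (𝒜 := coordGrading G hG) (coordHom (hF := hG) ψ _ h0)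
        (g (coord F hF i)) (h2 ▸ isUnit_one)
      rw [coordHom_comp_algebraMap] at hs
      refine ⟨awayHom (coordHom (hF := hG) ψ _ h0) (g (coord F hF i)) (h2 ▸ isUnit_one), ?_, hs⟩
      apply hx.away_hom_ext (hx.mem i)
      · rw [RingHom.comp_assoc, awayMap_comp_awayScalar g φ hgR, ← RingHom.comp_assoc, hs, hαψ]
      · intro k
        rw [RingHom.comp_apply, awayMap_ratio, awayHom_ratio_of_eq_one _ _ _ _ _ h2, h1]
    · intro T _ χ χ' h1 h2
      refine hy.away_hom_ext (hy.mem i) h2 fun k => ?_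
      have := RingHom.congr_fun h1 (ratio (hx.mem i) (hx.mem k))
      rwa [RingHom.comp_apply, RingHom.comp_apply, awayMap_ratio] at this
  have hr : ∀ i, Proj.map g hirr ⁻¹ᵁ
      (Proj.awayι (coordGrading F hF) (coord F hF i) (hx.mem i) Nat.one_pos).opensRange ≤
      (Proj.awayι (coordGrading G hG) (g (coord F hF i)) (hy.mem i) Nat.one_pos).opensRange := by
    intro i
    rw [Proj.opensRange_awayι, Proj.opensRange_awayι, Proj.map_preimage_basicOpen]
  exact ⟨Proj.map g hirr, isPullback_of_openCovers (map_comp_projToSpec g hirr φ hgR)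
    hx.cover.openCover (Scheme.coverOfIsIso.{0} (𝟙 _)) _ (fun i _ => ho i)
    (fun i _ => Spec.map (CommRingCat.ofHom (Away.map g (coord F hF i))))
    (fun i _ => Spec.map (CommRingCat.ofHom (awayScalar _ (g (coord F hF i)))))
    (fun i _ => (Proj.awayι_comp_map g hirr Nat.one_pos _ (hx.mem i)).symm)
    (fun i _ => (Category.comp_id _).trans (awayι_projToSpec _ _ _).symm)
    (fun i _ => hsq i) (fun i _ => inf_le_left.trans (hr i))⟩

end BaseChange

/-! ### Linear changes of coordinates -/

section LinearChange

attribute [local instance] MvPolynomial.gradedAlgebra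

open scoped Graded

/-- Mutually inverse homomorphisms of graded `R`-algebras induce an isomorphism of their `Proj` over
`R`. -/
theorem nonempty_projIso {R A B : Type} [CommRing R] [CommRing A] [CommRing B] [Algebra R A]
    [Algebra R B] {𝒜 : ℕ → Submodule R A} [GradedAlgebra 𝒜] {ℬ : ℕ → Submodule R B}
    [GradedAlgebra ℬ] (g : 𝒜 →+*ᵍ ℬ) (h : ℬ →+*ᵍ 𝒜)
    (hg : ∀ r, g (algebraMap R A r) = algebraMap R B r) (hgh : g.comp h = .id ℬ)
    (hhg : h.comp g = .id 𝒜) :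
    Nonempty (Over.mk (projToSpec ℬ) ≅ Over.mk (projToSpec 𝒜)) := by
  have aux : ∀ {A B : Type} [CommRing A] [CommRing B] [Algebra R A] [Algebra R B]
      {𝒜 : ℕ → Submodule R A} [GradedAlgebra 𝒜] {ℬ : ℕ → Submodule R B} [GradedAlgebra ℬ]
      (g : 𝒜 →+*ᵍ ℬ) (h : ℬ →+*ᵍ 𝒜), g.comp h = .id ℬ →
      HomogeneousIdeal.irrelevant ℬ ≤ (HomogeneousIdeal.irrelevant 𝒜).map g := by
    intro A B _ _ _ _ 𝒜 _ ℬ _ g h hgh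
    change (HomogeneousIdeal.irrelevant ℬ).toIdeal ≤ ((HomogeneousIdeal.irrelevant 𝒜).map g).toIdeal
    rw [HomogeneousIdeal.toIdeal_irrelevant_le]
    intro n hn b hb
    have hb' : g (h b) = b := by
      have := congrArg (fun k : ℬ →+*ᵍ ℬ => k b) hgh
      exact this
    rw [← hb']
    exact Ideal.mem_map_of_mem _ (HomogeneousIdeal.mem_irrelevant_of_mem _ hn (Graded.map_mem h hb))
  have h1 := aux g h hgh
  have h2 := aux h g hhg
  have e : ∀ {C : Type} [CommRing C] [Algebra R C] {𝒞 : ℕ → Submodule R C} [GradedAlgebra 𝒞]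
      (k : 𝒞 →+*ᵍ 𝒞) (hk : HomogeneousIdeal.irrelevant 𝒞 ≤ (HomogeneousIdeal.irrelevant 𝒞).map k),
      k = .id 𝒞 → Proj.map k hk = 𝟙 _ := by
    rintro C _ _ 𝒞 _ _ hk rfl
    exact Proj.map_id
  refine ⟨Over.isoMk ⟨Proj.map g h1, Proj.map h h2, ?_, ?_⟩ ?_⟩
  · rw [← Proj.map_comp h g h2 h1]
    exact e _ _ hgh
  · rw [← Proj.map_comp g h h1 h2]
    exact e _ _ hhg
  · have := map_comp_projToSpec g h1 (RingHom.id R) hg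
    simpa using this

/-- The homomorphism of polynomial rings given by substitution of the linear forms of `ψ`. -/
noncomputable def linearSubst {σ τ : Type} [Fintype σ] [DecidableEq σ]
    (ψ : (σ → ℂ) →ₗ[ℂ] (τ → ℂ)) : MvPolynomial τ ℂ →ₐ[ℂ] MvPolynomial σ ℂ :=
  aeval fun j => ∑ i, C (ψ (Pi.single i 1) j) * X i

variable {σ τ ι κ : Type}

theorem eval_linearSubst [Fintype σ] [DecidableEq σ] (ψ : (σ → ℂ) →ₗ[ℂ] (τ → ℂ))
    (P : MvPolynomial τ ℂ) (x : σ → ℂ) : eval x (linearSubst ψ P) = eval (ψ x) P := by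
  have h : ((aeval x).comp (linearSubst ψ) : MvPolynomial τ ℂ →ₐ[ℂ] ℂ) = aeval (ψ x) := by
    ext j
    have hx : x = ∑ i, x i • (Pi.single i (1 : ℂ) : σ → ℂ) := by
      ext k
      simp [Finset.sum_apply, Pi.single_apply]
    conv_rhs => rw [hx]
    simp [linearSubst, mul_comm]
  have := DFunLike.congr_fun h P
  simpa [aeval_eq_eval] using this

theorem linearSubst_isHomogeneous [Fintype σ] [DecidableEq σ] (ψ : (σ → ℂ) →ₗ[ℂ] (τ → ℂ))
    (P : MvPolynomial τ ℂ) {n : ℕ} (hP : P.IsHomogeneous n) :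
    (linearSubst ψ P).IsHomogeneous n := by
  rw [← one_mul n]
  refine hP.aeval _ fun j => ?_
  exact IsHomogeneous.sum _ _ _ fun i _ => (isHomogeneous_X ℂ i).C_mul _

/-- A polynomial whose function is a linear combination of the functions of `F` lies in the ideal
generated by `F`. -/
theorem mem_span_of_eval_mem (F : ι → MvPolynomial σ ℂ) (P : MvPolynomial σ ℂ)
    (h : (fun x => eval x P) ∈ Submodule.span ℂ (Set.range fun i x => eval x (F i))) :
    P ∈ Ideal.span (Set.range F) := by
  let E : MvPolynomial σ ℂ →ₗ[ℂ] ((σ → ℂ) → ℂ) :=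
    { toFun := fun P x => eval x P
      map_add' := fun P Q => by ext; simp
      map_smul' := fun c P => by ext; simp }
  have h1 : (Set.range fun i x => eval x (F i)) = E '' Set.range F := by
    rw [← Set.range_comp]
    rfl
  rw [h1, Submodule.span_image] at h
  obtain ⟨Q, hQ, hQP⟩ := h
  have : Q = P := MvPolynomial.funext fun x => congrFun hQP x
  rw [← this]
  exact Submodule.span_le_restrictScalars ℂ (MvPolynomial σ ℂ) (Set.range F) hQ

/-- A linear isomorphism that transforms the span of the equations `G` into that of `F`
induces an isomorphism of the projective schemes `{F = 0}` and `{G = 0}`. -/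
theorem nonempty_projZeros_iso [Fintype σ] [Fintype τ] (F : ι → MvPolynomial σ ℂ)
    (hF : ∀ j, ∃ n, (F j).IsHomogeneous n)
    (G : κ → MvPolynomial τ ℂ) (hG : ∀ j, ∃ n, (G j).IsHomogeneous n)
    (φ : (σ → ℂ) ≃ₗ[ℂ] (τ → ℂ))
    (h1 : ∀ j, (fun x => eval (φ x) (G j)) ∈ Submodule.span ℂ (Set.range fun i x => eval x (F i)))
    (h2 : ∀ i, (fun x => eval x (F i)) ∈
      Submodule.span ℂ (Set.range fun j x => eval (φ x) (G j))) :
    Nonempty (Over.mk (projZerosToSpec F hF) ≅ Over.mk (projZerosToSpec G hG)) := by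
  classical
  have h1' : ∀ j, linearSubst φ.toLinearMap (G j) ∈ Ideal.span (Set.range F) := fun j =>
    mem_span_of_eval_mem F _ (by simp only [eval_linearSubst]; exact h1 j)
  have h2' : ∀ i, linearSubst φ.symm.toLinearMap (F i) ∈ Ideal.span (Set.range G) := by
    refine fun i => mem_span_of_eval_mem G _ ?_
    simp only [eval_linearSubst]
    let E : ((σ → ℂ) → ℂ) →ₗ[ℂ] ((τ → ℂ) → ℂ) :=
      { toFun := fun f y => f (φ.symm y)
        map_add' := fun _ _ => rfl
        map_smul' := fun _ _ => rfl }
    have := Submodule.mem_map_of_mem (f := E) (h2 i)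
    rw [Submodule.map_span, ← Set.range_comp] at this
    have h3 : (E ∘ fun j x => eval (φ x) (G j)) = fun j y => eval y (G j) := by
      ext j y
      simp [E]
    rwa [h3] at this
  let g := coordMap G hG F hF (linearSubst φ.toLinearMap : MvPolynomial τ ℂ →+* MvPolynomial σ ℂ)
    (fun n P hP => linearSubst_isHomogeneous _ P hP) h1'
  let h := coordMap F hF G hG
    (linearSubst φ.symm.toLinearMap : MvPolynomial σ ℂ →+* MvPolynomial τ ℂ)
    (fun n P hP => linearSubst_isHomogeneous _ P hP) h2'
  refine nonempty_projIso g h ?_ ?_ ?_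
  · intro r
    change Ideal.Quotient.mk _ (linearSubst φ.toLinearMap (algebraMap ℂ _ r)) = _
    rw [AlgHom.commutes]
    rfl
  · apply DFunLike.ext
    intro z
    obtain ⟨P, rfl⟩ := Ideal.Quotient.mk_surjective z
    change Ideal.Quotient.mk _ (linearSubst φ.toLinearMap (linearSubst φ.symm.toLinearMap P)) =
      Ideal.Quotient.mk _ P
    congr 1
    exact MvPolynomial.funext fun x => by simp [eval_linearSubst]
  · apply DFunLike.ext
    intro z
    obtain ⟨P, rfl⟩ := Ideal.Quotient.mk_surjective z
    change Ideal.Quotient.mk _ (linearSubst φ.symm.toLinearMap (linearSubst φ.toLinearMap P)) =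
      Ideal.Quotient.mk _ P
    congr 1
    exact MvPolynomial.funext fun x => by simp [eval_linearSubst]

end LinearChange

/-! ### Projections onto projective spaces -/

section Projections

attribute [local instance] MvPolynomial.gradedAlgebra

open HomogeneousLocalization

variable {R A : Type} [CommRing R] [CommRing A] [Algebra R A] {𝒜 : ℕ → Submodule R A}
  [GradedAlgebra 𝒜]

theorem algebraMap_mul_val_awayMap_ratio {f g a : A} (hf : f ∈ 𝒜 1) {e : ℕ} (hg : g ∈ 𝒜 e)
    (ha : a ∈ 𝒜 1) {x : A} (hx : x = f * g) :
    algebraMap A (Localization.Away x) f * (awayMap 𝒜 hg hx (ratio hf ha)).val =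
      algebraMap A (Localization.Away x) a := by
  rw [val_awayMap]
  have h := congrArg (Localization.awayLift (algebraMap A (Localization.Away x)) f
    (isUnit_of_dvd_unit (map_dvd _ ⟨g, hx⟩) (isUnit_algebraMap_away x)))
    (algebraMap_mul_val_ratio hf ha)
  rw [map_mul, Localization.awayLift, IsLocalization.Away.lift_eq,
    IsLocalization.Away.lift_eq] at h
  exact h

theorem awayMap_mul_comp_awayScalar {f g : A} {e : ℕ} (hg : g ∈ 𝒜 e) {x : A} (hx : x = f * g) :
    (awayMap 𝒜 hg hx).comp (awayScalar 𝒜 f) = awayScalar 𝒜 x := by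
  ext r
  change (awayMap 𝒜 hg hx (fromZeroRingHom 𝒜 _ (algebraMap R (𝒜 0) r))).val = _
  rw [awayMap_fromZeroRingHom]
  rfl

theorem awayι_preimage_basicOpen_of_degree_one {f a : A} (hf : f ∈ 𝒜 1) (ha : a ∈ 𝒜 1) :
    Proj.awayι 𝒜 f hf Nat.one_pos ⁻¹ᵁ Proj.basicOpen 𝒜 a =
      PrimeSpectrum.basicOpen (ratio hf ha) := by
  rw [Proj.awayι_preimage_basicOpen 𝒜 hf Nat.one_pos ha Nat.one_pos]
  congr 1
  apply HomogeneousLocalization.val_injective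
  rw [ratio, Away.val_mk, Away.val_mk, pow_one]

variable {τ : Type}

/-- Two `T`-valued points of a projective space in different charts coincide if their vectors of
coordinates are proportional. -/
theorem SpecMap_awayι_eq_of_proportional {T : Type} [CommRing T] {i k : τ}
    (g : Away (homogeneousSubmodule τ R) (X i) →+* T)
    (h : Away (homogeneousSubmodule τ R) (X k) →+* T)
    (hs : g.comp (awayScalar _ _) = h.comp (awayScalar _ _)) (c : T)
    (hc : ∀ m, g (ratio (X_mem i) (X_mem m)) =
      c * h (ratio (X_mem k) (X_mem m))) :
    Spec.map (CommRingCat.ofHom g) ≫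
        Proj.awayι (homogeneousSubmodule τ R) (X i) (X_mem i) Nat.one_pos =
      Spec.map (CommRingCat.ofHom h) ≫
        Proj.awayι (homogeneousSubmodule τ R) (X k) (X_mem k) Nat.one_pos := by
  have hX := isGeneratedBy_X (R := R) (σ := τ)
  let Φ : MvPolynomial τ R →+* T := eval₂Hom (g.comp (awayScalar _ _))
    fun m => g (ratio (X_mem i) (X_mem m))
  have hΦX : ∀ m, Φ (X m) = g (ratio (X_mem i) (X_mem m)) := fun m => by
    simp [Φ]
  have hΦC : Φ.comp (algebraMap R _) = g.comp (awayScalar _ _) := by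
    ext r
    simp [Φ, algebraMap_eq]
  have hi : Φ (X i) = 1 := by
    rw [hΦX]
    exact (congrArg g (ratio_self (X_mem i))).trans (map_one g)
  have hk : Φ (X k) = c := by
    rw [hΦX, hc]
    have := (congrArg h (ratio_self (X_mem k))).trans (map_one h)
    rw [this, mul_one]
  have hcu : IsUnit c := by
    refine IsUnit.of_mul_eq_one (h (ratio (X_mem k) (X_mem i))) ?_
    rw [← hc, ← hΦX, hi]
  have hui : IsUnit (Φ (X i)) := hi ▸ isUnit_one
  have huk : IsUnit (Φ (X k)) := hk ▸ hcu
  have e1 : g = awayHom Φ (X i) hui := by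
    apply hX.away_hom_ext (hX.mem i)
    · rw [awayHom_comp_awayScalar, hΦC]
    · intro m
      rw [awayHom_ratio_of_eq_one _ _ _ _ _ hi, hΦX]
  have e2 : h = awayHom Φ (X k) huk := by
    apply hX.away_hom_ext (hX.mem k)
    · rw [awayHom_comp_awayScalar, hΦC, hs]
    · intro m
      apply huk.mul_left_cancel
      rw [mul_awayHom_ratio, hk, hΦX, hc]
  rw [e1, e2]
  exact SpecMap_awayHom_awayι Φ _ _ _ _ _ _

/-- The homomorphism of coordinate rings `X m / X i ↦ x (u m) / x s`, by which a projection onto a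
projective space is given on the chart at the generator `x s`. -/
noncomputable def chartHom {σ : Type} {x : σ → A} (hx : ∀ s, x s ∈ 𝒜 1) (s : σ)
    (u : τ → σ) (i : τ) (hu : u i = s) :
    Away (homogeneousSubmodule τ R) (X i) →+* Away 𝒜 (x s) :=
  awayHom (eval₂Hom (awayScalar 𝒜 (x s)) fun m => ratio (hx s) (hx (u m))) (X i) (by
    rw [coe_eval₂Hom, eval₂_X, ratio_congr (hx s) (hx (u i)) (hx s) (by rw [hu]), ratio_self]
    exact isUnit_one)

section chartHom

variable {σ : Type} {x : σ → A} (hx : ∀ s, x s ∈ 𝒜 1) (s : σ) (u : τ → σ) (i : τ) (hu : u i = s)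

theorem chartHom_ratio (m : τ) :
    chartHom hx s u i hu (ratio (X_mem i) (X_mem m)) =
      ratio (hx s) (hx (u m)) := by
  rw [chartHom, awayHom_ratio_of_eq_one, coe_eval₂Hom, eval₂_X]
  rw [coe_eval₂Hom, eval₂_X, ratio_congr (hx s) (hx (u i)) (hx s) (by rw [hu]), ratio_self]

theorem chartHom_comp_awayScalar :
    (chartHom hx s u i hu).comp (awayScalar (homogeneousSubmodule τ R) (X i)) =
      awayScalar 𝒜 (x s) := by
  rw [chartHom, awayHom_comp_awayScalar]
  ext r
  simp [algebraMap_eq]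

end chartHom

/-- Projections onto a projective space that are given on the chart at `x s` by the vector
`(x (up s m) / x s)` glue if these vectors are proportional on overlaps. -/
theorem IsGeneratedBy.exists_projection {σ : Type} {x : σ → A} (hx : IsGeneratedBy 𝒜 x)
    (i : σ → τ) (up : σ → τ → σ) (hup : ∀ s, up s (i s) = s)
    (hrel : ∀ s t m, x (up s m) * x t = x (up s (i t)) * x (up t m)) :
    ∃ p : Proj 𝒜 ⟶ Proj (homogeneousSubmodule τ R),
      p ≫ projToSpec (homogeneousSubmodule τ R) = projToSpec 𝒜 ∧
      ∀ s, Proj.awayι 𝒜 (x s) (hx.mem s) Nat.one_pos ≫ p =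
        Spec.map (CommRingCat.ofHom (chartHom hx.mem s (up s) (i s) (hup s))) ≫
          Proj.awayι (homogeneousSubmodule τ R) (X (i s)) (X_mem _) Nat.one_pos := by
  let f : ∀ s, Spec (.of (Away 𝒜 (x s))) ⟶ Proj (homogeneousSubmodule τ R) := fun s =>
    Spec.map (CommRingCat.ofHom (chartHom hx.mem s (up s) (i s) (hup s))) ≫
      Proj.awayι (homogeneousSubmodule τ R) (X (i s)) (X_mem _) Nat.one_pos
  have hf : ∀ s t, pullback.fst (Proj.awayι 𝒜 (x s) (hx.mem s) Nat.one_pos)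
      (Proj.awayι 𝒜 (x t) (hx.mem t) Nat.one_pos) ≫ f s = pullback.snd _ _ ≫ f t := by
    intro s t
    rw [← cancel_epi (Proj.pullbackAwayιIso 𝒜 (hx.mem s) Nat.one_pos (hx.mem t) Nat.one_pos
      rfl).inv, Proj.pullbackAwayιIso_inv_fst_assoc, Proj.pullbackAwayιIso_inv_snd_assoc]
    change Spec.map _ ≫ Spec.map _ ≫ _ = Spec.map _ ≫ Spec.map _ ≫ _
    rw [← Spec.map_comp_assoc, ← Spec.map_comp_assoc, ← CommRingCat.ofHom_comp,
      ← CommRingCat.ofHom_comp]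
    refine SpecMap_awayι_eq_of_proportional _ _ ?_
      (awayMap 𝒜 (hx.mem t) rfl (ratio (hx.mem s) (hx.mem (up s (i t))))) ?_
    · rw [RingHom.comp_assoc, RingHom.comp_assoc, chartHom_comp_awayScalar,
        chartHom_comp_awayScalar, awayMap_mul_comp_awayScalar, awayMap_mul_comp_awayScalar]
    · intro m
      rw [RingHom.comp_apply, RingHom.comp_apply, chartHom_ratio, chartHom_ratio]
      apply HomogeneousLocalization.val_injective
      apply (isUnit_algebraMap_away (x s * x t)).mul_left_cancel
      rw [HomogeneousLocalization.val_mul, map_mul]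
      have e1 := algebraMap_mul_val_awayMap_ratio (hx.mem s) (hx.mem t) (hx.mem (up s m)) rfl
      have e2 := algebraMap_mul_val_awayMap_ratio (hx.mem s) (hx.mem t) (hx.mem (up s (i t))) rfl
      have e3 := algebraMap_mul_val_awayMap_ratio (hx.mem t) (hx.mem s) (hx.mem (up t m))
        (mul_comm (x s) (x t))
      have e4 := congrArg (algebraMap A (Localization.Away (x s * x t))) (hrel s t m)
      rw [map_mul, map_mul] at e4
      calc _ = algebraMap A (Localization.Away (x s * x t)) (x (up s m)) *
            algebraMap A (Localization.Away (x s * x t)) (x t) := by rw [← e1]; ring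
        _ = _ := by rw [e4, ← e2, ← e3]; ring
  obtain ⟨p, hp⟩ : ∃ p : Proj 𝒜 ⟶ Proj (homogeneousSubmodule τ R),
      ∀ s, Proj.awayι 𝒜 (x s) (hx.mem s) Nat.one_pos ≫ p = f s :=
    ⟨hx.cover.openCover.glueMorphisms f hf, hx.cover.openCover.ι_glueMorphisms f hf⟩
  have e : ∀ s, Proj.awayι 𝒜 (x s) (hx.mem s) Nat.one_pos ≫
      p ≫ projToSpec (homogeneousSubmodule τ R) =
        Proj.awayι 𝒜 (x s) (hx.mem s) Nat.one_pos ≫ projToSpec 𝒜 := by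
    intro s
    rw [← Category.assoc, hp, Category.assoc, awayι_projToSpec, awayι_projToSpec, ← Spec.map_comp,
      ← CommRingCat.ofHom_comp, chartHom_comp_awayScalar]
  exact ⟨p, hx.cover.openCover.hom_ext _ _ e, hp⟩

/-- If a morphism is given on the chart at `x s` by the vector `(x (u m) / x s)`, then `D₊(X m)`
pulls back to `D₊(x (u m))` there. -/
theorem preimage_basicOpen_of_chartHom {σ : Type} {x : σ → A} (hx : ∀ s, x s ∈ 𝒜 1) (s : σ)
    (u : τ → σ) (i : τ) (hu : u i = s) {p : Proj 𝒜 ⟶ Proj (homogeneousSubmodule τ R)}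
    (hp : Proj.awayι 𝒜 (x s) (hx s) Nat.one_pos ≫ p =
        Spec.map (CommRingCat.ofHom (chartHom hx s u i hu)) ≫
          Proj.awayι (homogeneousSubmodule τ R) (X i) (X_mem _) Nat.one_pos) (m : τ) :
    Proj.awayι 𝒜 (x s) (hx s) Nat.one_pos ⁻¹ᵁ p ⁻¹ᵁ Proj.basicOpen _ (X m) =
      PrimeSpectrum.basicOpen (ratio (hx s) (hx (u m))) := by
  rw [← Scheme.Hom.comp_preimage, hp, Scheme.Hom.comp_preimage,
    awayι_preimage_basicOpen_of_degree_one (X_mem i) (X_mem m),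
    ← chartHom_ratio hx s u i hu m]
  rfl

end Projections

/-! ### The Segre embedding -/

section Segre

attribute [local instance] MvPolynomial.gradedAlgebra

open HomogeneousLocalization

/-- The `2 × 2` minors of the generic `3 × 3` matrix, indexed by the complementary entry; the rows
and columns are taken in cyclic order, so that no signs occur. -/
noncomputable def segreEquation (ij : Fin 3 × Fin 3) : MvPolynomial (Fin 3 × Fin 3) ℂ :=
  X (ij.1 + 1, ij.2 + 1) * X (ij.1 + 2, ij.2 + 2) - X (ij.1 + 1, ij.2 + 2) * X (ij.1 + 2, ij.2 + 1)

theorem segreEquation_isHomogeneous (ij : Fin 3 × Fin 3) :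
    ∃ n, (segreEquation ij).IsHomogeneous n :=
  ⟨2, ((isHomogeneous_X ℂ _).mul (isHomogeneous_X ℂ _)).sub
    ((isHomogeneous_X ℂ _).mul (isHomogeneous_X ℂ _))⟩

/-- The vanishing of the nine minors in cyclic order gives all `2 × 2` relations. -/
theorem mul_eq_mul_of_minors {T : Type*} [CommRing T] (v : Fin 3 × Fin 3 → T)
    (h : ∀ ij : Fin 3 × Fin 3, v (ij.1 + 1, ij.2 + 1) * v (ij.1 + 2, ij.2 + 2) -
      v (ij.1 + 1, ij.2 + 2) * v (ij.1 + 2, ij.2 + 1) = 0) (i j k l : Fin 3) :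
    v (i, j) * v (k, l) = v (i, l) * v (k, j) := by
  have key : ∀ i j : Fin 3, v (i, j) * v (i + 1, j + 1) = v (i, j + 1) * v (i + 1, j) := by
    intro i j
    have e : ∀ i : Fin 3, i + 2 + 1 = i ∧ i + 2 + 2 = i + 1 := by decide
    have hij : v (i + 2 + 1, j + 2 + 1) * v (i + 2 + 2, j + 2 + 2) -
      v (i + 2 + 1, j + 2 + 2) * v (i + 2 + 2, j + 2 + 1) = 0 := h (i + 2, j + 2)
    rw [(e i).1, (e i).2, (e j).1, (e j).2] at hij
    exact sub_eq_zero.1 hij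
  have h3 : ∀ i k : Fin 3, k = i ∨ k = i + 1 ∨ i = k + 1 := by decide
  rcases h3 i k with rfl | rfl | rfl
  · rw [mul_comm]
  · rcases h3 j l with rfl | rfl | rfl
    · rfl
    · exact key i j
    · exact (key i l).symm
  · rcases h3 j l with rfl | rfl | rfl
    · rfl
    · rw [mul_comm, ← key k j, mul_comm]
    · rw [mul_comm, key k l, mul_comm]

/-- The Segre isomorphism: the scheme defined by the `2 × 2` minors of the generic `3 × 3` matrix
is `ℙ² × ℙ²`. -/
theorem nonempty_segre_iso :
    Nonempty (Over.mk (projZerosToSpec segreEquation segreEquation_isHomogeneous) ≅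
      planeTimesPlane) := by
  let 𝒜 := coordGrading segreEquation segreEquation_isHomogeneous
  let x := coord segreEquation segreEquation_isHomogeneous
  have hx : IsGeneratedBy 𝒜 x := isGeneratedBy_coord _ _
  have hX := isGeneratedBy_X (R := ℂ) (σ := Fin 3)
  have hrel : ∀ i j k l, x (i, j) * x (k, l) = x (i, l) * x (k, j) :=
    mul_eq_mul_of_minors x fun ij => by
      have := aeval_coord_eq_zero segreEquation segreEquation_isHomogeneous ij
      simpa [segreEquation] using this
  obtain ⟨p, hp, hpc⟩ := hx.exists_projection (fun s => s.1) (fun s m => (m, s.2)) (fun _ => rfl)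
    fun s t m => (hrel _ _ _ _).trans (by rw [mul_comm])
  obtain ⟨q, hq, hqc⟩ := hx.exists_projection (fun s => s.2) (fun s m => (s.1, m)) (fun _ => rfl)
    fun s t m => hrel _ _ _ _
  -- On charts: the nine functions `x (k, l)` on `D₊(X i) × D₊(X j)` are the products of the
  -- coordinates of the factors.
  have hsq : ∀ i j, IsPullback
      (Spec.map (CommRingCat.ofHom (chartHom hx.mem (i, j) (fun m => (m, j)) i rfl)))
      (Spec.map (CommRingCat.ofHom (chartHom hx.mem (i, j) (fun m => (i, m)) j rfl)))
      (Proj.awayι (homogeneousSubmodule (Fin 3) ℂ) (X i) (X_mem i) Nat.one_pos ≫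
        projToSpec (homogeneousSubmodule (Fin 3) ℂ))
      (Proj.awayι (homogeneousSubmodule (Fin 3) ℂ) (X j) (X_mem j) Nat.one_pos ≫
        projToSpec (homogeneousSubmodule (Fin 3) ℂ)) := by
    intro i j
    rw [awayι_projToSpec, awayι_projToSpec]
    apply isPullback_SpecMap
    · rw [chartHom_comp_awayScalar, chartHom_comp_awayScalar]
    · intro T _ α β hαβ
      let v : Fin 3 × Fin 3 → T := fun kl =>
        α (ratio (X_mem i) (X_mem kl.1)) * β (ratio (X_mem j) (X_mem kl.2))
      have h0 : ∀ kl, eval₂ (α.comp (awayScalar _ _)) v (segreEquation kl) = 0 := by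
        intro kl
        simp only [segreEquation, eval₂_sub, eval₂_mul, eval₂_X, v]
        ring
      have hc : ∀ kl, coordHom (hF := segreEquation_isHomogeneous) _ v h0 (x kl) = v kl :=
        fun kl => coordHom_coord _ _ _ _ _ _
      have hi : α (ratio (X_mem i) (X_mem i)) = 1 := by rw [ratio_self, map_one]
      have hj : β (ratio (X_mem j) (X_mem j)) = 1 := by rw [ratio_self, map_one]
      have h1 : coordHom (hF := segreEquation_isHomogeneous) _ v h0 (x (i, j)) = 1 := by
        rw [hc]
        simp only [v, hi, hj, mul_one]
      have hs := awayHom_comp_awayScalar (𝒜 := 𝒜)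
        (coordHom (hF := segreEquation_isHomogeneous) _ v h0) (x (i, j)) (h1 ▸ isUnit_one)
      rw [coordHom_comp_algebraMap] at hs
      refine ⟨awayHom (coordHom (hF := segreEquation_isHomogeneous) _ v h0) (x (i, j))
        (h1 ▸ isUnit_one), ?_, ?_⟩
      · apply hX.away_hom_ext (X_mem i)
        · rw [RingHom.comp_assoc, chartHom_comp_awayScalar, hs]
        · intro m
          rw [RingHom.comp_apply, chartHom_ratio, awayHom_ratio_of_eq_one _ _ _ _ _ h1, hc]
          simp only [v, hj, mul_one]
      · apply hX.away_hom_ext (X_mem j)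
        · rw [RingHom.comp_assoc, chartHom_comp_awayScalar, hs, hαβ]
        · intro m
          rw [RingHom.comp_apply, chartHom_ratio, awayHom_ratio_of_eq_one _ _ _ _ _ h1, hc]
          simp only [v, hi, one_mul]
    · intro T _ χ χ' h1 h2
      refine hx.away_hom_ext (hx.mem (i, j)) ?_ ?_
      · have := congrArg (fun k => k.comp (awayScalar _ _)) h1
        simpa only [RingHom.comp_assoc, chartHom_comp_awayScalar] using this
      · rintro ⟨k, l⟩
        have e : ratio (hx.mem (i, j)) (hx.mem (k, l)) =
            ratio (hx.mem (i, j)) (hx.mem (k, j)) * ratio (hx.mem (i, j)) (hx.mem (i, l)) := by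
          apply HomogeneousLocalization.val_injective
          apply ((isUnit_algebraMap_away (x (i, j))).pow 2).mul_left_cancel
          have e1 := algebraMap_mul_val_ratio (hx.mem (i, j)) (hx.mem (k, l))
          have e2 := algebraMap_mul_val_ratio (hx.mem (i, j)) (hx.mem (k, j))
          have e3 := algebraMap_mul_val_ratio (hx.mem (i, j)) (hx.mem (i, l))
          have e4 := congrArg (algebraMap _ (Localization.Away (x (i, j)))) (hrel i j k l)
          rw [map_mul, map_mul, ← e1, ← e2, ← e3] at e4
          rw [HomogeneousLocalization.val_mul]
          linear_combination e4
        have f1 := RingHom.congr_fun h1 (ratio (X_mem i) (X_mem k))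
        have f2 := RingHom.congr_fun h2 (ratio (X_mem j) (X_mem l))
        rw [RingHom.comp_apply, RingHom.comp_apply, chartHom_ratio] at f1 f2
        rw [e, map_mul, map_mul, f1, f2]
  -- The preimage of `D₊(X i) × D₊(X j)` is `D₊(x (i, j))`: on the chart at `x s`, with
  -- `s = (s.1, s.2)`, the relation `x (i, s.2) * x (s.1, j) = x (i, j) * x s` holds.
  have hr : ∀ i j, p ⁻¹ᵁ (Proj.awayι _ _ (X_mem (R := ℂ) i) Nat.one_pos).opensRange ⊓
      q ⁻¹ᵁ (Proj.awayι _ _ (X_mem (R := ℂ) j) Nat.one_pos).opensRange ≤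
        (Proj.awayι 𝒜 (x (i, j)) (hx.mem (i, j)) Nat.one_pos).opensRange := by
    intro i j
    rw [Proj.opensRange_awayι, Proj.opensRange_awayι, Proj.opensRange_awayι]
    rintro z ⟨hz1, hz2⟩
    obtain ⟨s, w, rfl⟩ : ∃ s, ∃ w, Proj.awayι 𝒜 (x s) (hx.mem s) Nat.one_pos w = z :=
      ⟨_, hx.cover.openCover.covers z⟩
    have h1 : w ∈ Proj.awayι 𝒜 (x s) (hx.mem s) Nat.one_pos ⁻¹ᵁ p ⁻¹ᵁ Proj.basicOpen _ (X i) := hz1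
    have h2 : w ∈ Proj.awayι 𝒜 (x s) (hx.mem s) Nat.one_pos ⁻¹ᵁ q ⁻¹ᵁ Proj.basicOpen _ (X j) := hz2
    rw [preimage_basicOpen_of_chartHom hx.mem s (fun m => (m, s.2)) s.1 rfl (hpc s) i] at h1
    rw [preimage_basicOpen_of_chartHom hx.mem s (fun m => (s.1, m)) s.2 rfl (hqc s) j] at h2
    change w ∈ Proj.awayι 𝒜 (x s) (hx.mem s) Nat.one_pos ⁻¹ᵁ Proj.basicOpen _ (x (i, j))
    rw [awayι_preimage_basicOpen_of_degree_one (hx.mem s) (hx.mem (i, j))]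
    have e : ratio (hx.mem s) (hx.mem (i, s.2)) * ratio (hx.mem s) (hx.mem (s.1, j)) =
        ratio (hx.mem s) (hx.mem (i, j)) := by
      apply HomogeneousLocalization.val_injective
      apply ((isUnit_algebraMap_away (x s)).pow 2).mul_left_cancel
      have e1 := algebraMap_mul_val_ratio (hx.mem s) (hx.mem (i, j))
      have e2 := algebraMap_mul_val_ratio (hx.mem s) (hx.mem (i, s.2))
      have e3 := algebraMap_mul_val_ratio (hx.mem s) (hx.mem (s.1, j))
      have e4 := congrArg (algebraMap _ (Localization.Away (x s))) (hrel i s.2 s.1 j)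
      rw [map_mul, map_mul, ← e2, ← e3, ← e1, Prod.mk.eta] at e4
      rw [HomogeneousLocalization.val_mul]
      linear_combination e4
    rw [← e, PrimeSpectrum.basicOpen_mul]
    exact ⟨h1, h2⟩
  have hpb : IsPullback p q projectivePlaneToSpec projectivePlaneToSpec :=
    isPullback_of_openCovers (hp.trans hq.symm) hX.cover.openCover hX.cover.openCover
      (fun i j => Proj.awayι 𝒜 (x (i, j)) (hx.mem (i, j)) Nat.one_pos)
      (fun _ _ => inferInstance) _ _ (fun i j => (hpc (i, j)).symm) (fun i j => (hqc (i, j)).symm)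
      hsq hr
  refine ⟨Over.isoMk hpb.isoPullback ?_⟩
  change hpb.isoPullback.hom ≫ pullback.fst _ _ ≫ projectivePlaneToSpec = projToSpec 𝒜
  exact (Category.assoc _ _ _).symm.trans
    ((congrArg (· ≫ projectivePlaneToSpec) hpb.isoPullback_hom_fst).trans hp)

end Segre

/-! ### The equations of the fibers -/

/-- The nine equations of the fiber of `ρ_Π` over the closed point `a`. -/
noncomputable def fiberEquation (a : BaseCoord → ℂ) (j : Fin 9) : MvPolynomial FiberCoord ℂ :=
  MvPolynomial.map (MvPolynomial.eval a) (piEquation j)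

theorem fiberEquation_isHomogeneous (a : BaseCoord → ℂ) (j : Fin 9) :
    ∃ n, (fiberEquation a j).IsHomogeneous n :=
  ⟨2, (piEquation_isHomogeneous j).map _⟩

theorem eval_fiberEquation (a : BaseCoord → ℂ) (x : FiberCoord → ℂ) (j : Fin 9) :
    eval x (fiberEquation a j) = nineEquations (x .p1) (x .p2) (x .p3) (x .p4) (x .u) (x .v)
      (a .t1) (a .t2) (a (.L .L123)) (a (.L .L124)) (a (.L .L125)) (a (.L .L126))
      (a (.L .L135)) (a (.L .L136)) (a (.L .L245)) (a (.L .L246)) (x .s1) (x .s2) (x .s3) j := by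
  rw [fiberEquation, piEquation, map_nineEquations, map_nineEquations]
  simp only [map_X, map_C, eval_X, eval_C]

/-- The scheme-theoretic fiber of `ρ_Π` is defined by the specialized equations. -/
theorem nonempty_rhoPiFiber_iso (a : BaseCoord → ℂ) :
    Nonempty (rhoPiFiber a ≅
      Over.mk (projZerosToSpec (fiberEquation a) (fiberEquation_isHomogeneous a))) := by
  obtain ⟨p, hp⟩ := exists_isPullback_projZeros piEquation
    (fun j => ⟨2, piEquation_isHomogeneous j⟩) (MvPolynomial.eval a)
    (fiberEquation_isHomogeneous a)
  exact ⟨(Over.isoMk hp.isoPullback hp.isoPullback_hom_snd).symm⟩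

/-! ### The normal form of the fibers -/

/-- The three cyclic rotations of a `2 × 2 × 2` hypermatrix: the `i`-th one has the `i`-th index of
`q` first, followed by the other two in cyclic order. -/
def rotate {S : Type*} (q : Fin 2 → Fin 2 → Fin 2 → S) : Fin 3 → Fin 2 → Fin 2 → Fin 2 → S :=
  ![q, fun i j k => q k i j, fun i j k => q j k i]

/-- The hypermatrix `q`, contracted with the `i`-th vector `x_i`. -/
def contraction {S : Type*} [CommRing S] (q : Fin 2 → Fin 2 → Fin 2 → S) (x : Fin 3 → Fin 2 → S)
    (i : Fin 3) (j k : Fin 2) : S :=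
  rotate q i 0 j k * x i 0 + rotate q i 1 j k * x i 1

/-- The hypermatrix `q`, contracted with the two vectors other than `x_i`. -/
def doubleContraction {S : Type*} [CommRing S] (q : Fin 2 → Fin 2 → Fin 2 → S)
    (x : Fin 3 → Fin 2 → S) (i : Fin 3) (r : Fin 2) : S :=
  rotate q i r 0 0 * x (i + 1) 0 * x (i + 2) 0 + rotate q i r 0 1 * x (i + 1) 0 * x (i + 2) 1 +
    rotate q i r 1 0 * x (i + 1) 1 * x (i + 2) 0 + rotate q i r 1 1 * x (i + 1) 1 * x (i + 2) 1

/-- The nine quadratic forms attached to a `2 × 2 × 2` hypermatrix `q`, in three vectors `x_i` of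
length two and three scalars `w_i`: with `J x = (-x₁, x₀)` they are the entries of
`w_i J x_i + q(·, x_{i+1}, x_{i+2})`, and `w_{i+1} w_{i+2} + det q(x_i, ·, ·)`. -/
def trilinearForm {S : Type*} [CommRing S] (q : Fin 2 → Fin 2 → Fin 2 → S)
    (x : Fin 3 → Fin 2 → S) (w : Fin 3 → S) : (Fin 3 × Fin 2) ⊕ Fin 3 → S
  | Sum.inl (i, r) => w i * (![-x i 1, x i 0] : Fin 2 → S) r + doubleContraction q x i r
  | Sum.inr i => w (i + 1) * w (i + 2) + (contraction q x i 0 0 * contraction q x i 1 1 -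
      contraction q x i 0 1 * contraction q x i 1 0)

/-- The forms `trilinearForm` as polynomials. -/
noncomputable def trilinearEquation (q : Fin 2 → Fin 2 → Fin 2 → ℂ) :
    (Fin 3 × Fin 2) ⊕ Fin 3 → MvPolynomial ((Fin 3 × Fin 2) ⊕ Fin 3) ℂ :=
  trilinearForm (fun i j k => C (q i j k)) (fun i r => X (Sum.inl (i, r))) fun i => X (Sum.inr i)

theorem rotate_C (q : Fin 2 → Fin 2 → Fin 2 → ℂ) (i : Fin 3) (r j k : Fin 2) {σ : Type} :
    rotate (fun i j k => (C (q i j k) : MvPolynomial σ ℂ)) i r j k = C (rotate q i r j k) := by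
  fin_cases i <;> rfl

theorem eval_trilinearEquation (q : Fin 2 → Fin 2 → Fin 2 → ℂ)
    (x : (Fin 3 × Fin 2) ⊕ Fin 3 → ℂ) (s : (Fin 3 × Fin 2) ⊕ Fin 3) :
    eval x (trilinearEquation q s) =
      trilinearForm q (fun i r => x (Sum.inl (i, r))) (fun i => x (Sum.inr i)) s := by
  rcases s with ⟨i, r⟩ | i
  · fin_cases r <;>
      simp [trilinearEquation, trilinearForm, doubleContraction, rotate_C]
  · simp [trilinearEquation, trilinearForm, contraction, rotate_C]

theorem trilinearEquation_isHomogeneous (q : Fin 2 → Fin 2 → Fin 2 → ℂ)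
    (s : (Fin 3 × Fin 2) ⊕ Fin 3) : ∃ n, (trilinearEquation q s).IsHomogeneous n := by
  have hX : ∀ s, (X s : MvPolynomial ((Fin 3 × Fin 2) ⊕ Fin 3) ℂ).IsHomogeneous 1 :=
    isHomogeneous_X ℂ
  have hCX : ∀ c s, (C c * X s : MvPolynomial ((Fin 3 × Fin 2) ⊕ Fin 3) ℂ).IsHomogeneous 1 :=
    fun c s => by simpa using (isHomogeneous_C _ c).mul (hX s)
  refine ⟨2, ?_⟩
  rcases s with ⟨i, r⟩ | i
  · have h : ((![-X (Sum.inl (i, 1)), X (Sum.inl (i, 0))] :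
        Fin 2 → MvPolynomial ((Fin 3 × Fin 2) ⊕ Fin 3) ℂ)
        r).IsHomogeneous 1 := by
      fin_cases r
      · exact (hX _).neg
      · exact hX _
    simp only [trilinearEquation, trilinearForm, doubleContraction, rotate_C]
    exact ((hX _).mul h).add (((((hCX _ _).mul (hX _)).add ((hCX _ _).mul (hX _))).add
      ((hCX _ _).mul (hX _))).add ((hCX _ _).mul (hX _)))
  · simp only [trilinearEquation, trilinearForm, contraction, rotate_C]
    exact ((hX _).mul (hX _)).add
      ((((hCX _ _).add (hCX _ _)).mul ((hCX _ _).add (hCX _ _))).sub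
        (((hCX _ _).add (hCX _ _)).mul ((hCX _ _).add (hCX _ _))))

/-- A quadratic polynomial with values in a vector space is determined by three values: if these
lie in a subspace, then so do the coefficients. -/
theorem mem_of_quadratic_mem {M : Type*} [AddCommGroup M] [Module ℂ M] (N : Submodule ℂ M)
    {a b c : ℂ} (hab : a ≠ b) (hac : a ≠ c) (hbc : b ≠ c) {p q r : M}
    (ha : p + a • q + a ^ 2 • r ∈ N) (hb : p + b • q + b ^ 2 • r ∈ N)
    (hc : p + c • q + c ^ 2 • r ∈ N) : p ∈ N ∧ q ∈ N ∧ r ∈ N := by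
  have h1 : q + (a + b) • r ∈ N := by
    rw [← N.smul_mem_iff (sub_ne_zero.2 hab)]
    convert N.sub_mem ha hb using 1
    module
  have h2 : q + (a + c) • r ∈ N := by
    rw [← N.smul_mem_iff (sub_ne_zero.2 hac)]
    convert N.sub_mem ha hc using 1
    module
  have hr : r ∈ N := by
    rw [← N.smul_mem_iff (sub_ne_zero.2 hbc)]
    convert N.sub_mem h1 h2 using 1
    module
  have hq : q ∈ N := (N.add_mem_iff_left (N.smul_mem _ hr)).1 h1
  exact ⟨(N.add_mem_iff_left (N.smul_mem a hq)).1 ((N.add_mem_iff_left (N.smul_mem _ hr)).1 ha),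
    hq, hr⟩

/-! ### Reduction of the fibers to the normal form -/

section Normalization

variable {S : Type*} [CommRing S]

/-- The roots of `x³ + t₁ x - t₂`, for `(t₁, t₂)` the image of `(A, B)` under the sextic cover. -/
def cubicRoot (A B : S) : Fin 3 → S := ![A, B, -(A + B)]

/-- The triple with sum zero and given first two entries. -/
def zeroSum (a b : S) : Fin 3 → S := ![a, b, -(a + b)]

/-- The hypermatrix of the fiber in terms of `c = (L₁₃₅, L₁₃₆, L₂₄₅, L₂₄₆)` and of the partial
fractions `l i = (L₁₂₃ - θ_i L₁₂₅) / f'(θ_i)` and `k i = (L₁₂₄ - θ_i L₁₂₆) / f'(θ_i)`, where the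
`θ_i` are the roots of `f = x³ + t₁ x - t₂`. -/
def normalHypermatrix (l k : Fin 3 → S) (c : Fin 4 → S) : Fin 2 → Fin 2 → Fin 2 → S :=
  ![![![-3 * c 3, 3 * (c 2 + k 2)], ![3 * (c 2 + k 1), 3 * (l 0 - c 1)]],
    ![![3 * (c 2 + k 0), 3 * (l 1 - c 1)], ![3 * (l 2 - c 1), 3 * c 0]]]

/-- The nine polynomials, with `L₁₂₃, …, L₁₂₆` expressed by the partial fractions: for distinct
roots, `∑ θ_i² l_i = L₁₂₃` and `∑ θ_i l_i = -L₁₂₅`, by Lagrange interpolation, and likewise for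
`k`. -/
def nineEquationsOfRoots (θ l k : Fin 3 → S) (c : Fin 4 → S) (x : FiberCoord → S) : Fin 9 → S :=
  nineEquations (x .p1) (x .p2) (x .p3) (x .p4) (x .u) (x .v)
    (θ 0 * θ 1 + θ 0 * θ 2 + θ 1 * θ 2) (θ 0 * θ 1 * θ 2)
    (θ 0 ^ 2 * l 0 + θ 1 ^ 2 * l 1 + θ 2 ^ 2 * l 2) (θ 0 ^ 2 * k 0 + θ 1 ^ 2 * k 1 + θ 2 ^ 2 * k 2)
    (-(θ 0 * l 0 + θ 1 * l 1 + θ 2 * l 2)) (-(θ 0 * k 0 + θ 1 * k 1 + θ 2 * k 2))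
    (c 0) (c 1) (c 2) (c 3) (x .s1) (x .s2) (x .s3)

/-- The vectors `x_i` of the normal form of the fiber: up to order and sign, the values at `θ_i` of
the quadratic polynomials `u - p₁ T - p₂ T²` and `v - p₃ T - p₄ T²`. -/
def normalVector (θ : Fin 3 → S) (x : FiberCoord → S) (i : Fin 3) : Fin 2 → S :=
  ![x .v - x .p3 * θ i - x .p4 * θ i ^ 2, -(x .u - x .p1 * θ i - x .p2 * θ i ^ 2)]

/-- The scalars `w_i` of the normal form of the fiber: three times the values at `θ_i` of the quadratic
polynomial `s₃ + s₂ T + s₁ (T² + t₁)`, corrected by a linear form in the vectors. -/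
def normalScalar (θ l k : Fin 3 → S) (x : FiberCoord → S) (i : Fin 3) : S :=
  3 * (x .s3 + θ i * x .s2 + (θ i ^ 2 + (θ 0 * θ 1 + θ 0 * θ 2 + θ 1 * θ 2)) * x .s1 +
    (-(l (i + 2) * normalVector θ x (i + 1) 1) - l (i + 1) * normalVector θ x (i + 2) 1 +
      k (i + 2) * normalVector θ x (i + 1) 0 + k (i + 1) * normalVector θ x (i + 2) 0))

/-- The nine forms `trilinearForm` in the normal coordinates of the fiber. -/
def normalForm (θ l k : Fin 3 → S) (c : Fin 4 → S) (x : FiberCoord → S) :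
    (Fin 3 × Fin 2) ⊕ Fin 3 → S :=
  trilinearForm (normalHypermatrix l k c) (normalVector θ x) (normalScalar θ l k x)

variable (A B l₀ l₁ k₀ k₁ : S) (c : Fin 4 → S) (x : FiberCoord → S)

/-- The first components of the normal forms are the values at the roots of the quadratic polynomial
`F₅ + T F₃ + (T² + t₁) F₁`. -/
theorem normalForm_inl_zero (i : Fin 3) :
    normalForm (cubicRoot A B) (zeroSum l₀ l₁) (zeroSum k₀ k₁) c x (Sum.inl (i, 0)) =
      3 * (nineEquationsOfRoots (cubicRoot A B) (zeroSum l₀ l₁) (zeroSum k₀ k₁) c x 4 +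
        cubicRoot A B i *
          nineEquationsOfRoots (cubicRoot A B) (zeroSum l₀ l₁) (zeroSum k₀ k₁) c x 2 +
        (cubicRoot A B i ^ 2 - (A ^ 2 + A * B + B ^ 2)) *
          nineEquationsOfRoots (cubicRoot A B) (zeroSum l₀ l₁) (zeroSum k₀ k₁) c x 0) := by
  fin_cases i <;>
  · simp only [normalForm, trilinearForm, doubleContraction, rotate, normalHypermatrix,
      normalVector, normalScalar, nineEquationsOfRoots, nineEquations, cubicRoot, zeroSum,
      Matrix.cons_val, Fin.zero_eta, Fin.mk_one, Fin.reduceFinMk, Fin.reduceAdd, Fin.isValue,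
      zero_add]
    ring

/-- The second components of the normal forms are the values at the roots of the quadratic
polynomial `F₆ + T F₄ + (T² + t₁) F₂`. -/
theorem normalForm_inl_one (i : Fin 3) :
    normalForm (cubicRoot A B) (zeroSum l₀ l₁) (zeroSum k₀ k₁) c x (Sum.inl (i, 1)) =
      3 * (nineEquationsOfRoots (cubicRoot A B) (zeroSum l₀ l₁) (zeroSum k₀ k₁) c x 5 +
        cubicRoot A B i *
          nineEquationsOfRoots (cubicRoot A B) (zeroSum l₀ l₁) (zeroSum k₀ k₁) c x 3 +
        (cubicRoot A B i ^ 2 - (A ^ 2 + A * B + B ^ 2)) *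
          nineEquationsOfRoots (cubicRoot A B) (zeroSum l₀ l₁) (zeroSum k₀ k₁) c x 1) := by
  fin_cases i <;>
  · simp only [normalForm, trilinearForm, doubleContraction, rotate, normalHypermatrix,
      normalVector, normalScalar, nineEquationsOfRoots, nineEquations, cubicRoot, zeroSum,
      Matrix.cons_val, Fin.zero_eta, Fin.mk_one, Fin.reduceFinMk, Fin.reduceAdd, Fin.isValue,
      zero_add]
    ring

/-- The remaining normal forms are, modulo the other six, the values at the roots of the quadratic
polynomial `F₉ - T F₈ - T² F₇`. -/
theorem normalForm_inr (i : Fin 3) :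
    normalForm (cubicRoot A B) (zeroSum l₀ l₁) (zeroSum k₀ k₁) c x (Sum.inr i) =
      9 * (nineEquationsOfRoots (cubicRoot A B) (zeroSum l₀ l₁) (zeroSum k₀ k₁) c x 8 -
        cubicRoot A B i *
          nineEquationsOfRoots (cubicRoot A B) (zeroSum l₀ l₁) (zeroSum k₀ k₁) c x 7 -
        cubicRoot A B i ^ 2 *
          nineEquationsOfRoots (cubicRoot A B) (zeroSum l₀ l₁) (zeroSum k₀ k₁) c x 6) +
      3 * zeroSum l₀ l₁ i *
        (normalForm (cubicRoot A B) (zeroSum l₀ l₁) (zeroSum k₀ k₁) c x (Sum.inl (i + 1, 0)) +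
          normalForm (cubicRoot A B) (zeroSum l₀ l₁) (zeroSum k₀ k₁) c x (Sum.inl (i + 2, 0)) -
          normalForm (cubicRoot A B) (zeroSum l₀ l₁) (zeroSum k₀ k₁) c x (Sum.inl (i, 0))) +
      3 * zeroSum k₀ k₁ i *
        (normalForm (cubicRoot A B) (zeroSum l₀ l₁) (zeroSum k₀ k₁) c x (Sum.inl (i + 1, 1)) +
          normalForm (cubicRoot A B) (zeroSum l₀ l₁) (zeroSum k₀ k₁) c x (Sum.inl (i + 2, 1)) -
          normalForm (cubicRoot A B) (zeroSum l₀ l₁) (zeroSum k₀ k₁) c x (Sum.inl (i, 1))) := by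
  fin_cases i <;>
  · simp only [normalForm, trilinearForm, contraction, doubleContraction, rotate,
      normalHypermatrix, normalVector, normalScalar, nineEquationsOfRoots, nineEquations,
      cubicRoot, zeroSum, Matrix.cons_val, Fin.zero_eta, Fin.mk_one, Fin.reduceFinMk,
      Fin.reduceAdd, Fin.isValue, zero_add]
    ring

end Normalization

instance : Fintype FiberCoord where
  elems := {.p1, .p2, .p3, .p4, .u, .v, .s1, .s2, .s3}
  complete x := by cases x <;> decide

/-- The passage to the normal coordinates of the fiber. -/
def normalCoordinates (θ l k : Fin 3 → ℂ) :
    (FiberCoord → ℂ) →ₗ[ℂ] ((Fin 3 × Fin 2) ⊕ Fin 3 → ℂ) where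
  toFun x := Sum.elim (fun s => normalVector θ x s.1 s.2) (normalScalar θ l k x)
  map_add' x y := by
    ext s
    rcases s with ⟨i, r⟩ | i
    · fin_cases r <;>
      · simp only [normalVector, Sum.elim_inl, Pi.add_apply, Matrix.cons_val, Fin.zero_eta,
          Fin.mk_one, Fin.isValue]
        ring
    · simp only [normalScalar, normalVector, Sum.elim_inr, Pi.add_apply, Matrix.cons_val]
      ring
  map_smul' a x := by
    ext s
    rcases s with ⟨i, r⟩ | i
    · fin_cases r <;>
      · simp only [normalVector, Sum.elim_inl, Pi.smul_apply, Matrix.cons_val, Fin.zero_eta,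
          Fin.mk_one, Fin.isValue, smul_eq_mul, RingHom.id_apply]
        ring
    · simp only [normalScalar, normalVector, Sum.elim_inr, Pi.smul_apply, Matrix.cons_val,
        smul_eq_mul, RingHom.id_apply]
      ring

theorem normalCoordinates_injective {θ : Fin 3 → ℂ} (hθ : Function.Injective θ)
    (l k : Fin 3 → ℂ) : Function.Injective (normalCoordinates θ l k) := by
  have h01 : θ 0 ≠ θ 1 := hθ.ne (by decide)
  have h02 : θ 0 ≠ θ 2 := hθ.ne (by decide)
  have h12 : θ 1 ≠ θ 2 := hθ.ne (by decide)
  have key : ∀ a b c : ℂ, (∀ i, a + b * θ i + c * θ i ^ 2 = 0) → a = 0 ∧ b = 0 ∧ c = 0 := by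
    intro a b c h
    have h' : ∀ i, a + θ i • b + θ i ^ 2 • c ∈ (⊥ : Submodule ℂ ℂ) := fun i => by
      rw [Submodule.mem_bot, ← h i]
      simp only [smul_eq_mul]
      ring
    simpa only [Submodule.mem_bot] using
      mem_of_quadratic_mem ⊥ h01 h02 h12 (h' 0) (h' 1) (h' 2)
  refine (injective_iff_map_eq_zero _).2 fun x hx => ?_
  have hV : ∀ i r, normalVector θ x i r = 0 := fun i r => congrFun hx (Sum.inl (i, r))
  have hW : ∀ i, normalScalar θ l k x i = 0 := fun i => congrFun hx (Sum.inr i)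
  obtain ⟨h1, h2, h3⟩ := key (x .v) (-x .p3) (-x .p4) fun i => by
    have := hV i 0
    simp only [normalVector, Matrix.cons_val] at this
    linear_combination this
  obtain ⟨h4, h5, h6⟩ := key (x .u) (-x .p1) (-x .p2) fun i => by
    have := hV i 1
    simp only [normalVector, Matrix.cons_val] at this
    linear_combination -this
  obtain ⟨h7, h8, h9⟩ := key (x .s3 + (θ 0 * θ 1 + θ 0 * θ 2 + θ 1 * θ 2) * x .s1) (x .s2) (x .s1)
    fun i => by
      have := hW i
      simp only [normalScalar, hV] at this
      linear_combination this / 3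
  rw [h9, mul_zero, add_zero] at h7
  rw [neg_eq_zero] at h2 h3 h5 h6
  ext s
  cases s <;> assumption

/-- The nine polynomials and the nine normal forms span each other, since the former are recovered
from the latter by interpolation at the three roots. -/
theorem nonempty_projZeros_iso_trilinear {A B : ℂ} (hθ : Function.Injective (cubicRoot A B))
    (l₀ l₁ k₀ k₁ : ℂ) (c : Fin 4 → ℂ) (F : Fin 9 → MvPolynomial FiberCoord ℂ)
    (hF : ∀ j, ∃ n, (F j).IsHomogeneous n)
    (h : ∀ x j, eval x (F j) =
      nineEquationsOfRoots (cubicRoot A B) (zeroSum l₀ l₁) (zeroSum k₀ k₁) c x j) :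
    Nonempty (Over.mk (projZerosToSpec F hF) ≅
      Over.mk (projZerosToSpec
        (trilinearEquation (normalHypermatrix (zeroSum l₀ l₁) (zeroSum k₀ k₁) c))
        (trilinearEquation_isHomogeneous _))) := by
  have h01 : cubicRoot A B 0 ≠ cubicRoot A B 1 := hθ.ne (by decide)
  have h02 : cubicRoot A B 0 ≠ cubicRoot A B 2 := hθ.ne (by decide)
  have h12 : cubicRoot A B 1 ≠ cubicRoot A B 2 := hθ.ne (by decide)
  let φ : (FiberCoord → ℂ) ≃ₗ[ℂ] ((Fin 3 × Fin 2) ⊕ Fin 3 → ℂ) :=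
    LinearEquiv.ofInjectiveOfFinrankEq
      (normalCoordinates (cubicRoot A B) (zeroSum l₀ l₁) (zeroSum k₀ k₁))
      (normalCoordinates_injective hθ _ _) (by
        rw [Module.finrank_fintype_fun_eq_card, Module.finrank_fintype_fun_eq_card]
        rfl)
  let g : Fin 9 → (FiberCoord → ℂ) → ℂ := fun j x => MvPolynomial.eval x (F j)
  let e : (Fin 3 × Fin 2) ⊕ Fin 3 → (FiberCoord → ℂ) → ℂ := fun s x => MvPolynomial.eval (φ x)
    (trilinearEquation (normalHypermatrix (zeroSum l₀ l₁) (zeroSum k₀ k₁) c) s)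
  have hφ : ∀ x s, e s x = normalForm (cubicRoot A B) (zeroSum l₀ l₁) (zeroSum k₀ k₁) c x s :=
    fun x s => eval_trilinearEquation _ _ _
  replace h : ∀ x j, g j x =
    nineEquationsOfRoots (cubicRoot A B) (zeroSum l₀ l₁) (zeroSum k₀ k₁) c x j := h
  have h0 : ∀ i, e (Sum.inl (i, 0)) = (3 : ℂ) • ((g 4 - (A ^ 2 + A * B + B ^ 2) • g 0) +
      cubicRoot A B i • g 2 + cubicRoot A B i ^ 2 • g 0) := by
    intro i
    ext x
    change e (Sum.inl (i, 0)) x =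
      3 * ((g 4 x - _ * g 0 x) + cubicRoot A B i * g 2 x + cubicRoot A B i ^ 2 * g 0 x)
    rw [hφ, h, h, h, normalForm_inl_zero]
    ring
  have h1 : ∀ i, e (Sum.inl (i, 1)) = (3 : ℂ) • ((g 5 - (A ^ 2 + A * B + B ^ 2) • g 1) +
      cubicRoot A B i • g 3 + cubicRoot A B i ^ 2 • g 1) := by
    intro i
    ext x
    change e (Sum.inl (i, 1)) x =
      3 * ((g 5 x - _ * g 1 x) + cubicRoot A B i * g 3 x + cubicRoot A B i ^ 2 * g 1 x)
    rw [hφ, h, h, h, normalForm_inl_one]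
    ring
  have h2 : ∀ i, e (Sum.inr i) =
      (9 : ℂ) • (g 8 + cubicRoot A B i • (-g 7) + cubicRoot A B i ^ 2 • (-g 6)) +
      ((3 * zeroSum l₀ l₁ i) •
        (e (Sum.inl (i + 1, 0)) + e (Sum.inl (i + 2, 0)) - e (Sum.inl (i, 0))) +
      (3 * zeroSum k₀ k₁ i) •
        (e (Sum.inl (i + 1, 1)) + e (Sum.inl (i + 2, 1)) - e (Sum.inl (i, 1)))) := by
    intro i
    ext x
    change e (Sum.inr i) x =
      9 * (g 8 x + cubicRoot A B i * (-g 7 x) + cubicRoot A B i ^ 2 * (-g 6 x)) +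
      (3 * zeroSum l₀ l₁ i *
        (e (Sum.inl (i + 1, 0)) x + e (Sum.inl (i + 2, 0)) x - e (Sum.inl (i, 0)) x) +
      3 * zeroSum k₀ k₁ i *
        (e (Sum.inl (i + 1, 1)) x + e (Sum.inl (i + 2, 1)) x - e (Sum.inl (i, 1)) x))
    rw [hφ, hφ, hφ, hφ, hφ, hφ, hφ, h, h, h, normalForm_inr]
    ring
  refine nonempty_projZeros_iso F hF _ _ φ ?_ ?_
  · change ∀ s, e s ∈ Submodule.span ℂ (Set.range g)
    have hg : ∀ j, g j ∈ Submodule.span ℂ (Set.range g) := fun j => Submodule.subset_span ⟨j, rfl⟩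
    generalize Submodule.span ℂ (Set.range g) = N at hg
    have he0 : ∀ i, e (Sum.inl (i, 0)) ∈ N := fun i => by
      rw [h0]
      exact N.smul_mem _ (N.add_mem (N.add_mem (N.sub_mem (hg _) (N.smul_mem _ (hg _)))
        (N.smul_mem _ (hg _))) (N.smul_mem _ (hg _)))
    have he1 : ∀ i, e (Sum.inl (i, 1)) ∈ N := fun i => by
      rw [h1]
      exact N.smul_mem _ (N.add_mem (N.add_mem (N.sub_mem (hg _) (N.smul_mem _ (hg _)))
        (N.smul_mem _ (hg _))) (N.smul_mem _ (hg _)))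
    rintro (⟨i, r⟩ | i)
    · fin_cases r
      · exact he0 i
      · exact he1 i
    · rw [h2]
      exact N.add_mem (N.smul_mem _ (N.add_mem (N.add_mem (hg _) (N.smul_mem _ (N.neg_mem (hg _))))
        (N.smul_mem _ (N.neg_mem (hg _))))) (N.add_mem
          (N.smul_mem _ (N.sub_mem (N.add_mem (he0 _) (he0 _)) (he0 _)))
          (N.smul_mem _ (N.sub_mem (N.add_mem (he1 _) (he1 _)) (he1 _))))
  · change ∀ j, g j ∈ Submodule.span ℂ (Set.range e)
    have he : ∀ s, e s ∈ Submodule.span ℂ (Set.range e) := fun s => Submodule.subset_span ⟨s, rfl⟩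
    generalize Submodule.span ℂ (Set.range e) = N at he
    have h3 : (3 : ℂ) ≠ 0 := by norm_num
    have h9 : (9 : ℂ) ≠ 0 := by norm_num
    obtain ⟨m4, m2, m0⟩ := mem_of_quadratic_mem N h01 h02 h12
      ((N.smul_mem_iff h3).1 (h0 0 ▸ he _)) ((N.smul_mem_iff h3).1 (h0 1 ▸ he _))
      ((N.smul_mem_iff h3).1 (h0 2 ▸ he _))
    obtain ⟨m5, m3, m1⟩ := mem_of_quadratic_mem N h01 h02 h12
      ((N.smul_mem_iff h3).1 (h1 0 ▸ he _)) ((N.smul_mem_iff h3).1 (h1 1 ▸ he _))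
      ((N.smul_mem_iff h3).1 (h1 2 ▸ he _))
    have h2' : ∀ i, g 8 + cubicRoot A B i • (-g 7) + cubicRoot A B i ^ 2 • (-g 6) ∈ N := by
      intro i
      rw [← N.smul_mem_iff h9, ← N.add_mem_iff_left (N.add_mem
        (N.smul_mem _ (N.sub_mem (N.add_mem (he _) (he _)) (he _)))
        (N.smul_mem _ (N.sub_mem (N.add_mem (he _) (he _)) (he _)))), ← h2 i]
      exact he _
    obtain ⟨m8, m7, m6⟩ := mem_of_quadratic_mem N h01 h02 h12 (h2' 0) (h2' 1) (h2' 2)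
    rw [N.sub_mem_iff_left (N.smul_mem _ m0)] at m4
    rw [N.sub_mem_iff_left (N.smul_mem _ m1)] at m5
    rw [N.neg_mem_iff] at m7 m6
    intro j
    fin_cases j <;> assumption

/-! ### Decomposable hypermatrices -/

section Decomposable

variable {S : Type*} [CommRing S]

/-- The minor of a `3 × 3` matrix complementary to the entry `(i, j)`, in cyclic order. -/
def cyclicMinor (m : Fin 3 → Fin 3 → S) (i j : Fin 3) : S :=
  m (i + 1) (j + 1) * m (i + 2) (j + 2) - m (i + 1) (j + 2) * m (i + 2) (j + 1)

/-- The `2 × 2` determinants `a_i ∧ b_i`. -/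
def wedge (a b : Fin 3 → Fin 2 → S) (i : Fin 3) : S := a i 0 * b i 1 - a i 1 * b i 0

/-- The scalar products `a_i · x_i`. -/
def pairing (a x : Fin 3 → Fin 2 → S) (i : Fin 3) : S := a i 0 * x i 0 + a i 1 * x i 1

/-- The hypermatrix `a₀ ⊗ a₁ ⊗ a₂ + b₀ ⊗ b₁ ⊗ b₂`. -/
def decomposableHypermatrix (a b : Fin 3 → Fin 2 → S) (i j k : Fin 2) : S :=
  a 0 i * a 1 j * a 2 k + b 0 i * b 1 j * b 2 k

/-- The `3 × 3` matrix whose minors are equivalent to the normal forms for a decomposable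
hypermatrix. -/
def decomposableMatrix (ξ η w : Fin 3 → S) : Fin 3 → Fin 3 → S :=
  ![![w 0, ξ 2, -η 1], ![-η 2, w 1, ξ 0], ![ξ 1, -η 0, w 2]]

variable (a b x : Fin 3 → Fin 2 → S) (w : Fin 3 → S)

theorem trilinearForm_decomposable_inl (i : Fin 3) (r : Fin 2) :
    trilinearForm (decomposableHypermatrix a b) x (fun i => -(wedge a b i * w i))
      (Sum.inl (i, r)) =
    a i r * cyclicMinor (decomposableMatrix (pairing a x) (pairing b x) w) (i + 1) (i + 2) +
      b i r * cyclicMinor (decomposableMatrix (pairing a x) (pairing b x) w) (i + 2) (i + 1) := by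
  fin_cases i <;> fin_cases r <;>
  · simp only [trilinearForm, doubleContraction, rotate, decomposableHypermatrix, cyclicMinor,
      decomposableMatrix, pairing, wedge, Matrix.cons_val, Fin.zero_eta, Fin.mk_one,
      Fin.reduceFinMk, Fin.reduceAdd, Fin.isValue, zero_add]
    ring

theorem trilinearForm_decomposable_inr (i : Fin 3) :
    trilinearForm (decomposableHypermatrix a b) x (fun i => -(wedge a b i * w i)) (Sum.inr i) =
    wedge a b (i + 1) * wedge a b (i + 2) *
      cyclicMinor (decomposableMatrix (pairing a x) (pairing b x) w) i i := by
  fin_cases i <;>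
  · simp only [trilinearForm, contraction, rotate, decomposableHypermatrix, cyclicMinor,
      decomposableMatrix, pairing, wedge, Matrix.cons_val, Fin.zero_eta, Fin.mk_one,
      Fin.reduceFinMk, Fin.reduceAdd, Fin.isValue, zero_add]
    ring

end Decomposable

theorem eval_segreEquation (m : Fin 3 × Fin 3 → ℂ) (kl : Fin 3 × Fin 3) :
    MvPolynomial.eval m (segreEquation kl) =
      cyclicMinor (fun k l => m (k, l)) kl.1 kl.2 := by
  simp [segreEquation, cyclicMinor]

theorem eq_zero_of_pairing_eq_zero {a b x : Fin 3 → Fin 2 → ℂ} {i : Fin 3}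
    (h : wedge a b i ≠ 0) (ha : pairing a x i = 0) (hb : pairing b x i = 0) (r : Fin 2) :
    x i r = 0 := by
  simp only [pairing, wedge] at ha hb h
  fin_cases r
  · refine (mul_eq_zero.1 (?_ : (a i 0 * b i 1 - a i 1 * b i 0) * x i 0 = 0)).resolve_left h
    linear_combination b i 1 * ha - a i 1 * hb
  · refine (mul_eq_zero.1 (?_ : (a i 0 * b i 1 - a i 1 * b i 0) * x i 1 = 0)).resolve_left h
    linear_combination a i 0 * hb - b i 0 * ha

/-- The linear substitution from the normal coordinates to the entries of a `3 × 3` matrix. -/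
noncomputable def decomposableCoordinates (a b : Fin 3 → Fin 2 → ℂ) :
    ((Fin 3 × Fin 2) ⊕ Fin 3 → ℂ) →ₗ[ℂ] (Fin 3 × Fin 3 → ℂ) where
  toFun x kl := decomposableMatrix (pairing a fun i r => x (Sum.inl (i, r)))
    (pairing b fun i r => x (Sum.inl (i, r))) (fun i => -((wedge a b i)⁻¹ * x (Sum.inr i)))
    kl.1 kl.2
  map_add' x y := by
    ext ⟨k, l⟩
    fin_cases k <;> fin_cases l <;>
    · simp only [decomposableMatrix, pairing, Pi.add_apply, Matrix.cons_val, Fin.zero_eta,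
        Fin.mk_one, Fin.reduceFinMk, Fin.isValue]
      ring
  map_smul' c x := by
    ext ⟨k, l⟩
    fin_cases k <;> fin_cases l <;>
    · simp only [decomposableMatrix, pairing, Pi.smul_apply, Matrix.cons_val, Fin.zero_eta,
        Fin.mk_one, Fin.reduceFinMk, Fin.isValue, smul_eq_mul, RingHom.id_apply]
      ring

theorem decomposableCoordinates_injective {a b : Fin 3 → Fin 2 → ℂ} (h : ∀ i, wedge a b i ≠ 0) :
    Function.Injective (decomposableCoordinates a b) := by
  refine (injective_iff_map_eq_zero _).2 fun x hx => ?_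
  have hm : ∀ k l, decomposableMatrix (pairing a fun i r => x (Sum.inl (i, r)))
      (pairing b fun i r => x (Sum.inl (i, r))) (fun i => -((wedge a b i)⁻¹ * x (Sum.inr i))) k l =
      0 := fun k l => congrFun hx (k, l)
  have hξ : ∀ i, pairing a (fun i r => x (Sum.inl (i, r))) i = 0 := by
    intro i
    fin_cases i
    · exact hm 1 2
    · exact hm 2 0
    · exact hm 0 1
  have hη : ∀ i, pairing b (fun i r => x (Sum.inl (i, r))) i = 0 := by
    intro i
    rw [← neg_eq_zero]
    fin_cases i
    · exact hm 2 1
    · exact hm 0 2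
    · exact hm 1 0
  have hw : ∀ i, -((wedge a b i)⁻¹ * x (Sum.inr i)) = 0 := by
    intro i
    fin_cases i
    · exact hm 0 0
    · exact hm 1 1
    · exact hm 2 2
  ext s
  rcases s with ⟨i, r⟩ | i
  · exact eq_zero_of_pairing_eq_zero (x := fun i r => x (Sum.inl (i, r))) (h i) (hξ i) (hη i) r
  · exact (mul_eq_zero.1 (neg_eq_zero.1 (hw i))).resolve_left (inv_ne_zero (h i))

/-- For a decomposable hypermatrix the normal forms are equivalent to the `2 × 2` minors of the
generic `3 × 3` matrix. -/
theorem nonempty_trilinear_iso_segre {a b : Fin 3 → Fin 2 → ℂ} (h : ∀ i, wedge a b i ≠ 0) :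
    Nonempty (Over.mk (projZerosToSpec (trilinearEquation (decomposableHypermatrix a b))
        (trilinearEquation_isHomogeneous _)) ≅
      Over.mk (projZerosToSpec segreEquation segreEquation_isHomogeneous)) := by
  let φ : ((Fin 3 × Fin 2) ⊕ Fin 3 → ℂ) ≃ₗ[ℂ] (Fin 3 × Fin 3 → ℂ) :=
    LinearEquiv.ofInjectiveOfFinrankEq (decomposableCoordinates a b)
      (decomposableCoordinates_injective h) (by
        rw [Module.finrank_fintype_fun_eq_card, Module.finrank_fintype_fun_eq_card]
        rfl)
  let e : (Fin 3 × Fin 2) ⊕ Fin 3 → ((Fin 3 × Fin 2) ⊕ Fin 3 → ℂ) → ℂ :=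
    fun s x => MvPolynomial.eval x (trilinearEquation (decomposableHypermatrix a b) s)
  let g : Fin 3 × Fin 3 → ((Fin 3 × Fin 2) ⊕ Fin 3 → ℂ) → ℂ :=
    fun kl x => MvPolynomial.eval (φ x) (segreEquation kl)
  have hg : ∀ kl x, g kl x = cyclicMinor (decomposableMatrix
      (pairing a fun i r => x (Sum.inl (i, r))) (pairing b fun i r => x (Sum.inl (i, r)))
      fun i => -((wedge a b i)⁻¹ * x (Sum.inr i))) kl.1 kl.2 :=
    fun kl x => eval_segreEquation _ _
  have he : ∀ s x, e s x = trilinearForm (decomposableHypermatrix a b)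
      (fun i r => x (Sum.inl (i, r)))
      (fun i => -(wedge a b i * -((wedge a b i)⁻¹ * x (Sum.inr i)))) s := by
    intro s x
    have : (fun i => -(wedge a b i * -((wedge a b i)⁻¹ * x (Sum.inr i)))) =
        fun i => x (Sum.inr i) := by
      ext i
      rw [mul_neg, neg_neg, mul_inv_cancel_left₀ (h i)]
    rw [this]
    exact eval_trilinearEquation _ _ _
  have h1 : ∀ i r, e (Sum.inl (i, r)) = a i r • g (i + 1, i + 2) + b i r • g (i + 2, i + 1) := by
    intro i r
    ext x
    change e _ x = a i r * g _ x + b i r * g _ x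
    rw [he, hg, hg, trilinearForm_decomposable_inl]
  have h2 : ∀ i, e (Sum.inr i) = (wedge a b (i + 1) * wedge a b (i + 2)) • g (i, i) := by
    intro i
    ext x
    change e _ x = _ * g _ x
    rw [he, hg, trilinearForm_decomposable_inr]
  refine nonempty_projZeros_iso _ _ _ _ φ ?_ ?_
  · change ∀ kl, g kl ∈ Submodule.span ℂ (Set.range e)
    have hN : ∀ s, e s ∈ Submodule.span ℂ (Set.range e) := fun s => Submodule.subset_span ⟨s, rfl⟩
    generalize Submodule.span ℂ (Set.range e) = N at hN
    have hcases : ∀ k l : Fin 3, k = l ∨ ∃ i : Fin 3,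
        (k = i + 1 ∧ l = i + 2) ∨ (k = i + 2 ∧ l = i + 1) := by decide
    rintro ⟨k, l⟩
    rcases hcases k l with rfl | ⟨i, ⟨rfl, rfl⟩ | ⟨rfl, rfl⟩⟩
    · rw [← N.smul_mem_iff (mul_ne_zero (h (k + 1)) (h (k + 2))), ← h2]
      exact hN _
    · rw [← N.smul_mem_iff (h i)]
      have := N.sub_mem (N.smul_mem (b i 1) (hN (Sum.inl (i, 0))))
        (N.smul_mem (b i 0) (hN (Sum.inl (i, 1))))
      rw [h1, h1] at this
      convert this using 1
      rw [wedge]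
      module
    · rw [← N.smul_mem_iff (h i)]
      have := N.sub_mem (N.smul_mem (a i 0) (hN (Sum.inl (i, 1))))
        (N.smul_mem (a i 1) (hN (Sum.inl (i, 0))))
      rw [h1, h1] at this
      convert this using 1
      rw [wedge]
      module
  · change ∀ s, e s ∈ Submodule.span ℂ (Set.range g)
    have hN : ∀ s, g s ∈ Submodule.span ℂ (Set.range g) := fun s => Submodule.subset_span ⟨s, rfl⟩
    rintro (⟨i, r⟩ | i)
    · rw [h1]
      exact Submodule.add_mem _ (Submodule.smul_mem _ _ (hN _)) (Submodule.smul_mem _ _ (hN _))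
    · rw [h2]
      exact Submodule.smul_mem _ _ (hN _)

/-! ### Tangential hypermatrices -/

section Tangential

variable {S : Type*} [CommRing S]

/-- The hypermatrix `a ⊗ a ⊗ b + a ⊗ b ⊗ a + b ⊗ a ⊗ a`, a tangent vector to the variety of
decomposable tensors at `a₀ ⊗ a₁ ⊗ a₂`. -/
def tangentialHypermatrix (a b : Fin 3 → Fin 2 → S) (i j k : Fin 2) : S :=
  a 0 i * a 1 j * b 2 k + a 0 i * b 1 j * a 2 k + b 0 i * a 1 j * a 2 k

/-- The symmetric `3 × 3` matrix attached to a tangential hypermatrix. -/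
def tangentialMatrix (ξ w : Fin 3 → S) : Matrix (Fin 3) (Fin 3) S :=
  !![w 0, -ξ 2, -ξ 1; -ξ 2, w 1, -ξ 0; -ξ 1, -ξ 0, w 2]

theorem tangentialMatrix_comm (ξ w : Fin 3 → S) (i j : Fin 3) :
    tangentialMatrix ξ w i j = tangentialMatrix ξ w j i := by
  fin_cases i <;> fin_cases j <;> rfl

variable (a b x : Fin 3 → Fin 2 → S) (w : Fin 3 → S)

theorem trilinearForm_tangential_inl (i : Fin 3) (r : Fin 2) :
    trilinearForm (tangentialHypermatrix a b) x (fun i => wedge a b i * w i) (Sum.inl (i, r)) =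
    b i r * (tangentialMatrix (pairing a x) w).adjugate (i + 1) (i + 2) -
      a i r * (tangentialMatrix (pairing a x) w).mulVec (pairing b x) i := by
  fin_cases i <;> fin_cases r <;>
  · simp only [trilinearForm, doubleContraction, rotate, tangentialHypermatrix,
      Matrix.adjugate_fin_three, tangentialMatrix, Matrix.mulVec, dotProduct, Fin.sum_univ_three,
      pairing, wedge, Matrix.cons_val, Fin.zero_eta, Fin.mk_one, Matrix.of_apply,
      Fin.reduceFinMk, Fin.reduceAdd, Fin.isValue, zero_add]
    ring

theorem trilinearForm_tangential_inr (i : Fin 3) :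
    trilinearForm (tangentialHypermatrix a b) x (fun i => wedge a b i * w i) (Sum.inr i) =
    wedge a b (i + 1) * wedge a b (i + 2) *
      (tangentialMatrix (pairing a x) w).adjugate i i := by
  fin_cases i <;>
  · simp only [trilinearForm, contraction, rotate, tangentialHypermatrix,
      Matrix.adjugate_fin_three, tangentialMatrix, pairing, wedge, Matrix.cons_val, Fin.zero_eta,
      Fin.mk_one, Matrix.of_apply, Fin.reduceFinMk, Fin.reduceAdd, Fin.isValue, zero_add]
    ring

end Tangential

/-- The linear substitution from the normal coordinates to the entries of a symmetric `3 × 3` matrix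
and a vector. -/
noncomputable def tangentialCoordinates (a b : Fin 3 → Fin 2 → ℂ) :
    ((Fin 3 × Fin 2) ⊕ Fin 3 → ℂ) →ₗ[ℂ] (Sym2 (Fin 3) ⊕ Fin 3 → ℂ) where
  toFun x := Sum.elim
    (Sym2.lift ⟨fun k l => tangentialMatrix (pairing a fun i r => x (Sum.inl (i, r)))
      (fun i => (wedge a b i)⁻¹ * x (Sum.inr i)) k l, tangentialMatrix_comm _ _⟩)
    (pairing b fun i r => x (Sum.inl (i, r)))
  map_add' x y := by
    ext s
    rcases s with s | i
    · induction s with | h k l =>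
      fin_cases k <;> fin_cases l <;>
      · simp only [tangentialMatrix, pairing, Pi.add_apply, Sum.elim_inl, Sym2.lift_mk,
          Matrix.of_apply, Matrix.cons_val, Fin.zero_eta, Fin.mk_one, Fin.reduceFinMk, Fin.isValue]
        ring
    · simp only [pairing, Pi.add_apply, Sum.elim_inr]
      ring
  map_smul' c x := by
    ext s
    rcases s with s | i
    · induction s with | h k l =>
      fin_cases k <;> fin_cases l <;>
      · simp only [tangentialMatrix, pairing, Pi.smul_apply, Sum.elim_inl, Sym2.lift_mk,
          Matrix.of_apply, Matrix.cons_val, Fin.zero_eta, Fin.mk_one, Fin.reduceFinMk, Fin.isValue,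
          smul_eq_mul, RingHom.id_apply]
        ring
    · simp only [pairing, Pi.smul_apply, Sum.elim_inr, smul_eq_mul, RingHom.id_apply]
      ring

theorem tangentialCoordinates_injective {a b : Fin 3 → Fin 2 → ℂ} (h : ∀ i, wedge a b i ≠ 0) :
    Function.Injective (tangentialCoordinates a b) := by
  refine (injective_iff_map_eq_zero _).2 fun x hx => ?_
  have hm : ∀ k l, tangentialMatrix (pairing a fun i r => x (Sum.inl (i, r)))
      (fun i => (wedge a b i)⁻¹ * x (Sum.inr i)) k l = 0 :=
    fun k l => congrFun hx (Sum.inl s(k, l))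
  have hξ : ∀ i, pairing a (fun i r => x (Sum.inl (i, r))) i = 0 := by
    intro i
    rw [← neg_eq_zero]
    fin_cases i
    · exact hm 1 2
    · exact hm 2 0
    · exact hm 0 1
  have hη : ∀ i, pairing b (fun i r => x (Sum.inl (i, r))) i = 0 := fun i =>
    congrFun hx (Sum.inr i)
  have hw : ∀ i, (wedge a b i)⁻¹ * x (Sum.inr i) = 0 := by
    intro i
    fin_cases i
    · exact hm 0 0
    · exact hm 1 1
    · exact hm 2 2
  ext s
  rcases s with ⟨i, r⟩ | i
  · exact eq_zero_of_pairing_eq_zero (x := fun i r => x (Sum.inl (i, r))) (h i) (hξ i) (hη i) r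
  · exact (mul_eq_zero.1 (hw i)).resolve_left (inv_ne_zero (h i))

theorem adjugate_tangentialMatrix_comm {S : Type*} [CommRing S] (ξ w : Fin 3 → S) (i j : Fin 3) :
    (tangentialMatrix ξ w).adjugate i j = (tangentialMatrix ξ w).adjugate j i := by
  have : (tangentialMatrix ξ w).transpose = tangentialMatrix ξ w :=
    Matrix.ext fun i j => tangentialMatrix_comm ξ w j i
  have h := congrFun (congrFun (Matrix.adjugate_transpose (tangentialMatrix ξ w)) i) j
  rw [this] at h
  exact h.symm

/-- For a tangential hypermatrix the normal forms are equivalent to the equations of `ℙ^{2,2}`. -/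
theorem nonempty_trilinear_iso_degenerateDelPezzo {a b : Fin 3 → Fin 2 → ℂ}
    (h : ∀ i, wedge a b i ≠ 0) :
    Nonempty (Over.mk (projZerosToSpec (trilinearEquation (tangentialHypermatrix a b))
        (trilinearEquation_isHomogeneous _)) ≅ degenerateDelPezzo) := by
  let φ : ((Fin 3 × Fin 2) ⊕ Fin 3 → ℂ) ≃ₗ[ℂ] (Sym2 (Fin 3) ⊕ Fin 3 → ℂ) :=
    LinearEquiv.ofInjectiveOfFinrankEq (tangentialCoordinates a b)
      (tangentialCoordinates_injective h) (by
        rw [Module.finrank_fintype_fun_eq_card, Module.finrank_fintype_fun_eq_card]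
        rfl)
  let M : ((Fin 3 × Fin 2) ⊕ Fin 3 → ℂ) → Matrix (Fin 3) (Fin 3) ℂ := fun x =>
    tangentialMatrix (pairing a fun i r => x (Sum.inl (i, r)))
      (fun i => (wedge a b i)⁻¹ * x (Sum.inr i))
  let e : (Fin 3 × Fin 2) ⊕ Fin 3 → ((Fin 3 × Fin 2) ⊕ Fin 3 → ℂ) → ℂ :=
    fun s x => MvPolynomial.eval x (trilinearEquation (tangentialHypermatrix a b) s)
  let g : (Fin 3 × Fin 3) ⊕ Fin 3 → ((Fin 3 × Fin 2) ⊕ Fin 3 → ℂ) → ℂ :=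
    fun s x => MvPolynomial.eval (φ x) (delPezzoEquation s)
  have hM : ∀ x, symMatrix.map (MvPolynomial.eval (φ x)) = M x := by
    intro x
    ext k l
    change MvPolynomial.eval (φ x) (X (Sum.inl s(k, l))) = M x k l
    rw [eval_X]
    rfl
  have hgl : ∀ k l x, g (Sum.inl (k, l)) x = (M x).adjugate k l := by
    intro k l x
    have := congrFun (congrFun ((MvPolynomial.eval (φ x)).map_adjugate symMatrix) k) l
    rw [RingHom.mapMatrix_apply, RingHom.mapMatrix_apply, hM] at this
    exact this
  have hgr : ∀ i x, g (Sum.inr i) x =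
      (M x).mulVec (pairing b fun i r => x (Sum.inl (i, r))) i := by
    intro i x
    change MvPolynomial.eval (φ x) (symMatrix.mulVec sigmaVector i) = _
    have hσ : MvPolynomial.eval (φ x) ∘ sigmaVector =
        pairing b fun i r => x (Sum.inl (i, r)) := by
      ext j
      change MvPolynomial.eval (φ x) (X (Sum.inr j)) = _
      rw [eval_X]
      rfl
    rw [RingHom.map_mulVec, hM, hσ]
  have he : ∀ s x, e s x = trilinearForm (tangentialHypermatrix a b)
      (fun i r => x (Sum.inl (i, r)))
      (fun i => wedge a b i * ((wedge a b i)⁻¹ * x (Sum.inr i))) s := by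
    intro s x
    have : (fun i => wedge a b i * ((wedge a b i)⁻¹ * x (Sum.inr i))) =
        fun i => x (Sum.inr i) := by
      ext i
      rw [mul_inv_cancel_left₀ (h i)]
    rw [this]
    exact eval_trilinearEquation _ _ _
  have h1 : ∀ i r, e (Sum.inl (i, r)) =
      b i r • g (Sum.inl (i + 1, i + 2)) - a i r • g (Sum.inr i) := by
    intro i r
    ext x
    change e _ x = b i r * g _ x - a i r * g _ x
    rw [he, hgl, hgr, trilinearForm_tangential_inl]
  have h2 : ∀ i, e (Sum.inr i) =
      (wedge a b (i + 1) * wedge a b (i + 2)) • g (Sum.inl (i, i)) := by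
    intro i
    ext x
    change e _ x = _ * g _ x
    rw [he, hgl, trilinearForm_tangential_inr]
  have h3 : ∀ k l, g (Sum.inl (k, l)) = g (Sum.inl (l, k)) := by
    intro k l
    ext x
    rw [hgl, hgl, adjugate_tangentialMatrix_comm]
  refine nonempty_projZeros_iso _ _ _ _ φ ?_ ?_
  · change ∀ kl, g kl ∈ Submodule.span ℂ (Set.range e)
    have hN : ∀ s, e s ∈ Submodule.span ℂ (Set.range e) := fun s => Submodule.subset_span ⟨s, rfl⟩
    generalize Submodule.span ℂ (Set.range e) = N at hN
    have hcases : ∀ k l : Fin 3, k = l ∨ ∃ i : Fin 3,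
        (k = i + 1 ∧ l = i + 2) ∨ (k = i + 2 ∧ l = i + 1) := by decide
    have hoff : ∀ i : Fin 3, g (Sum.inl (i + 1, i + 2)) ∈ N := by
      intro i
      rw [← N.smul_mem_iff (h i)]
      have := N.sub_mem (N.smul_mem (a i 0) (hN (Sum.inl (i, 1))))
        (N.smul_mem (a i 1) (hN (Sum.inl (i, 0))))
      rw [h1, h1] at this
      convert this using 1
      rw [wedge]
      module
    rintro (⟨k, l⟩ | i)
    · rcases hcases k l with rfl | ⟨i, ⟨rfl, rfl⟩ | ⟨rfl, rfl⟩⟩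
      · rw [← N.smul_mem_iff (mul_ne_zero (h (k + 1)) (h (k + 2))), ← h2]
        exact hN _
      · exact hoff i
      · rw [h3]
        exact hoff i
    · rw [← N.smul_mem_iff (h i)]
      have := N.sub_mem (N.smul_mem (b i 0) (hN (Sum.inl (i, 1))))
        (N.smul_mem (b i 1) (hN (Sum.inl (i, 0))))
      rw [h1, h1] at this
      convert this using 1
      rw [wedge]
      module
  · change ∀ s, e s ∈ Submodule.span ℂ (Set.range g)
    have hN : ∀ s, g s ∈ Submodule.span ℂ (Set.range g) := fun s => Submodule.subset_span ⟨s, rfl⟩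
    rintro (⟨i, r⟩ | i)
    · rw [h1]
      exact Submodule.sub_mem _ (Submodule.smul_mem _ _ (hN _)) (Submodule.smul_mem _ _ (hN _))
    · rw [h2]
      exact Submodule.smul_mem _ _ (hN _)

/-! ### The hyperdeterminant -/

/-- A binary quadratic form with nonzero discriminant has two independent isotropic vectors. -/
theorem exists_isotropic_pair {α β γ : ℂ} (h : β ^ 2 - 4 * α * γ ≠ 0) :
    ∃ c d : Fin 2 → ℂ, α * c 0 ^ 2 + β * c 0 * c 1 + γ * c 1 ^ 2 = 0 ∧
      α * d 0 ^ 2 + β * d 0 * d 1 + γ * d 1 ^ 2 = 0 ∧ c 0 * d 1 - c 1 * d 0 ≠ 0 := by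
  by_cases hα : α = 0
  · subst hα
    have hβ : β ≠ 0 := fun hβ => h (by rw [hβ]; ring)
    refine ⟨![1, 0], ![γ, -β], ?_, ?_, ?_⟩ <;> simp only [Matrix.cons_val]
    · ring
    · ring
    · simpa using hβ
  · obtain ⟨s, hs⟩ := IsAlgClosed.exists_pow_nat_eq (β ^ 2 - 4 * α * γ) two_pos
    have hs0 : s ≠ 0 := fun h0 => h (by rw [← hs, h0]; ring)
    refine ⟨![-β + s, 2 * α], ![-β - s, 2 * α], ?_, ?_, ?_⟩ <;> simp only [Matrix.cons_val]
    · linear_combination α * hs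
    · linear_combination α * hs
    · have : (-β + s) * (2 * α) - 2 * α * (-β - s) = 4 * α * s := by ring
      rw [this]
      exact mul_ne_zero (mul_ne_zero (by norm_num) hα) hs0

/-- A singular `2 × 2` matrix is a product of a column and a row. -/
theorem exists_eq_mul_of_det_eq_zero {n : Fin 2 → Fin 2 → ℂ}
    (h : n 0 0 * n 1 1 - n 0 1 * n 1 0 = 0) : ∃ u v : Fin 2 → ℂ, ∀ j k, n j k = u j * v k := by
  by_cases h00 : n 0 0 = 0
  · rw [h00, zero_mul, zero_sub, neg_eq_zero, mul_eq_zero] at h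
    rcases h with h | h
    · refine ⟨![0, 1], n 1, fun j k => ?_⟩
      fin_cases j <;> fin_cases k <;> simp [h00, h]
    · refine ⟨fun j => n j 1, ![0, 1], fun j k => ?_⟩
      fin_cases j <;> fin_cases k <;> simp [h00, h]
  · refine ⟨![1, n 1 0 / n 0 0], n 0, fun j k => ?_⟩
    fin_cases j <;> fin_cases k <;> simp
    · field_simp
    · field_simp
      linear_combination h

theorem hyperdeterminant_decomposable (a b : Fin 3 → Fin 2 → ℂ) :
    hyperdeterminant (decomposableHypermatrix a b) =
      (wedge a b 0 * wedge a b 1 * wedge a b 2) ^ 2 := by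
  simp only [hyperdeterminant, decomposableHypermatrix, wedge]
  ring

theorem hyperdeterminant_tangential (a b : Fin 3 → Fin 2 → ℂ) :
    hyperdeterminant (tangentialHypermatrix a b) = 0 := by
  simp only [hyperdeterminant, tangentialHypermatrix]
  ring

/-- A hypermatrix with nonzero hyperdeterminant is decomposable: the hyperdeterminant is the
discriminant of the pencil of its two slices, whose two singular members have rank one. -/
theorem exists_eq_decomposableHypermatrix {p : Fin 2 → Fin 2 → Fin 2 → ℂ}
    (h : hyperdeterminant p ≠ 0) :
    ∃ a b, p = decomposableHypermatrix a b ∧ ∀ i, wedge a b i ≠ 0 := by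
  obtain ⟨c, d, hc, hd, hcd⟩ := exists_isotropic_pair
    (α := p 0 0 0 * p 0 1 1 - p 0 0 1 * p 0 1 0)
    (β := p 0 0 0 * p 1 1 1 + p 1 0 0 * p 0 1 1 - p 0 0 1 * p 1 1 0 - p 1 0 1 * p 0 1 0)
    (γ := p 1 0 0 * p 1 1 1 - p 1 0 1 * p 1 1 0) (by
      convert h using 1
      simp only [hyperdeterminant]
      ring)
  obtain ⟨u, v, huv⟩ := exists_eq_mul_of_det_eq_zero
    (n := fun j k => c 0 * p 0 j k + c 1 * p 1 j k) (by linear_combination hc)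
  obtain ⟨u', v', huv'⟩ := exists_eq_mul_of_det_eq_zero
    (n := fun j k => d 0 * p 0 j k + d 1 * p 1 j k) (by linear_combination hd)
  -- Solve the two rank-one members of the pencil for the slices, by Cramer's rule.
  obtain ⟨Δ, hΔ⟩ : ∃ Δ, Δ = c 0 * d 1 - c 1 * d 0 := ⟨_, rfl⟩
  rw [← hΔ] at hcd
  have hp : p = decomposableHypermatrix
      ![![d 1 / Δ, -d 0 / Δ], u, v] ![![-c 1 / Δ, c 0 / Δ], u', v'] := by
    ext i j k
    simp only [decomposableHypermatrix, Matrix.cons_val, mul_assoc, ← huv, ← huv']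
    fin_cases i <;> simp only [Matrix.cons_val, Fin.zero_eta, Fin.mk_one]
    · field_simp
      linear_combination p 0 j k * hΔ
    · field_simp
      linear_combination p 1 j k * hΔ
  refine ⟨_, _, hp, ?_⟩
  rw [hp, hyperdeterminant_decomposable] at h
  have h' := (pow_ne_zero_iff two_ne_zero).1 h
  intro i
  fin_cases i
  · exact left_ne_zero_of_mul (left_ne_zero_of_mul h')
  · exact right_ne_zero_of_mul (left_ne_zero_of_mul h')
  · exact right_ne_zero_of_mul h'

/-! ### The fibers -/

theorem cubicRoot_injective {AB : ℂ × ℂ} (h : AB ∈ planeOpen) :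
    Function.Injective (cubicRoot AB.1 AB.2) := by
  have h' : (AB.1 - AB.2) * (2 * AB.1 + AB.2) * (AB.1 + 2 * AB.2) ≠ 0 := h
  have h01 : AB.1 ≠ AB.2 := fun e => h' (by rw [e]; ring)
  have h02 : AB.1 ≠ -(AB.1 + AB.2) := fun e => h' (by
    have : 2 * AB.1 + AB.2 = 0 := by linear_combination e
    rw [this]
    ring)
  have h12 : AB.2 ≠ -(AB.1 + AB.2) := fun e => h' (by
    have : AB.1 + 2 * AB.2 = 0 := by linear_combination e
    rw [this]
    ring)
  intro i j hij
  fin_cases i <;> fin_cases j <;> first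
    | rfl
    | exact absurd hij h01
    | exact absurd hij h02
    | exact absurd hij h12
    | exact absurd hij.symm h01
    | exact absurd hij.symm h02
    | exact absurd hij.symm h12

/-- Over `U_{AB}` the fiber of `ρ_Π` is isomorphic to the normal form given by the hypermatrix. -/
theorem nonempty_rhoPiFiber_iso_trilinear {x : (ℂ × ℂ) × (LCoord → ℂ)} (hx : x.1 ∈ planeOpen) :
    Nonempty (rhoPiFiber (sexticCover x) ≅
      Over.mk (projZerosToSpec (trilinearEquation (hypermatrix x))
        (trilinearEquation_isHomogeneous _))) := by
  obtain ⟨⟨A, B⟩, L⟩ := x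
  have hAB : (A - B) * (2 * A + B) * (A + 2 * B) ≠ 0 := hx
  have h1 : A - B ≠ 0 := left_ne_zero_of_mul (left_ne_zero_of_mul hAB)
  have h2 : 2 * A + B ≠ 0 := right_ne_zero_of_mul (left_ne_zero_of_mul hAB)
  have h3 : A + 2 * B ≠ 0 := right_ne_zero_of_mul hAB
  -- The shape in which `field_simp` looks for the nonvanishing of the denominators.
  have h2' : A * 2 + B ≠ 0 := by rwa [mul_comm]
  have h3' : A + B * 2 ≠ 0 := by rwa [mul_comm B]
  let l₀ := (L .L123 - A * L .L125) / ((A - B) * (2 * A + B))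
  let l₁ := (-L .L123 + B * L .L125) / ((A - B) * (A + 2 * B))
  let k₀ := (L .L124 - A * L .L126) / ((A - B) * (2 * A + B))
  let k₁ := (-L .L124 + B * L .L126) / ((A - B) * (A + 2 * B))
  let c : Fin 4 → ℂ := ![L .L135, L .L136, L .L245, L .L246]
  have hp : hypermatrix ((A, B), L) = normalHypermatrix (zeroSum l₀ l₁) (zeroSum k₀ k₁) c := by
    ext i j k
    fin_cases i <;> fin_cases j <;> fin_cases k <;>
      simp only [hypermatrix, normalHypermatrix, zeroSum, Matrix.cons_val, Fin.zero_eta,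
        Fin.mk_one, Fin.isValue, l₀, l₁, k₀, k₁, c] <;> field_simp <;> ring
  have ht1 : sexticCover ((A, B), L) .t1 = A * B + A * -(A + B) + B * -(A + B) := by
    simp only [sexticCover]
    ring
  have ht2 : sexticCover ((A, B), L) .t2 = A * B * -(A + B) := by
    simp only [sexticCover]
    ring
  have h123 : L .L123 = A ^ 2 * l₀ + B ^ 2 * l₁ + (-(A + B)) ^ 2 * -(l₀ + l₁) := by
    simp only [l₀, l₁]
    field_simp
    ring
  have h125 : L .L125 = -(A * l₀ + B * l₁ + -(A + B) * -(l₀ + l₁)) := by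
    simp only [l₀, l₁]
    field_simp
    ring
  have h124 : L .L124 = A ^ 2 * k₀ + B ^ 2 * k₁ + (-(A + B)) ^ 2 * -(k₀ + k₁) := by
    simp only [k₀, k₁]
    field_simp
    ring
  have h126 : L .L126 = -(A * k₀ + B * k₁ + -(A + B) * -(k₀ + k₁)) := by
    simp only [k₀, k₁]
    field_simp
    ring
  have hF : ∀ y j, MvPolynomial.eval y (fiberEquation (sexticCover ((A, B), L)) j) =
      nineEquationsOfRoots (cubicRoot A B) (zeroSum l₀ l₁) (zeroSum k₀ k₁) c y j := by
    intro y j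
    rw [eval_fiberEquation, ht1, ht2]
    change nineEquations _ _ _ _ _ _ _ _ (L .L123) (L .L124) (L .L125) (L .L126)
      _ _ _ _ _ _ _ j = _
    rw [h123, h124, h125, h126]
    rfl
  obtain ⟨e⟩ := nonempty_rhoPiFiber_iso (sexticCover ((A, B), L))
  obtain ⟨e'⟩ := nonempty_projZeros_iso_trilinear (cubicRoot_injective hx) l₀ l₁ k₀ k₁ c
    (fiberEquation (sexticCover ((A, B), L))) (fiberEquation_isHomogeneous _) hF
  rw [hp]
  exact ⟨e ≪≫ e'⟩

/-- The sextic cover maps `U_{AB} × 𝔸(L)` onto the discriminant open set: `A` and `B` are two roots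
of `x³ + t₁ x - t₂`, whose discriminant is `-(4 t₁³ + 27 t₂²)`. -/
theorem exists_eq_sexticCover {a : BaseCoord → ℂ} (ha : a ∈ discriminantOpen) :
    ∃ x, x.1 ∈ planeOpen ∧ sexticCover x = a := by
  obtain ⟨A, hA⟩ : ∃ A, A ^ 3 + a .t1 * A - a .t2 = 0 := by
    have hdeg : (Polynomial.X ^ 3 + Polynomial.C (a .t1) * Polynomial.X -
        Polynomial.C (a .t2)).degree = 3 := by compute_degree!
    obtain ⟨A, hA⟩ := IsAlgClosed.exists_root _ (by rw [hdeg]; decide)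
    exact ⟨A, by simpa [Polynomial.IsRoot] using hA⟩
  -- The other two roots are those of `x² + A x + A² + t₁`, with discriminant `s²`.
  obtain ⟨s, hs⟩ := IsAlgClosed.exists_pow_nat_eq (-3 * A ^ 2 - 4 * a .t1) two_pos
  have h1 : -A ^ 2 - A * ((s - A) / 2) - ((s - A) / 2) ^ 2 = a .t1 := by
    linear_combination -hs / 4
  have h2 : -(A * ((s - A) / 2) * (A + (s - A) / 2)) = a .t2 := by
    linear_combination hA + A * h1
  have h : sexticCover ((A, (s - A) / 2), fun l => a (.L l)) = a := by
    ext i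
    cases i
    · exact h1
    · exact h2
    · rfl
  refine ⟨_, fun h0 => ha ?_, h⟩
  generalize (s - A) / 2 = B at *
  have h0' : (A - B) * (2 * A + B) * (A + 2 * B) = 0 := h0
  rw [← h1, ← h2]
  linear_combination -((A - B) * (2 * A + B) * (A + 2 * B)) * h0'

/-- The locus of base points with a general tangential hypermatrix. -/
def tangentialLocus : Set (BaseCoord → ℂ) :=
  sexticCover '' {x | x.1 ∈ planeOpen ∧
    ∃ a b, hypermatrix x = tangentialHypermatrix a b ∧ ∀ i, wedge a b i ≠ 0}

theorem tangentialLocus_subset : tangentialLocus ⊆ hyperdeterminantalLocus := by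
  rintro _ ⟨x, ⟨hx, a, b, h, -⟩, rfl⟩
  exact ⟨x, ⟨hx, by rw [h, hyperdeterminant_tangential]⟩, rfl⟩

theorem tangentialLocus_nonempty : tangentialLocus.Nonempty := by
  -- At `(A, B) = (1, 0)`, with `L₂₄₅ = 1` and all other `L` zero, the only nonzero entries of the
  -- hypermatrix are `p₁₁₂ = p₁₂₁ = p₂₁₁ = 3`.
  refine ⟨_, ((1, 0), fun l => if l = .L245 then 1 else 0), ⟨?_, ?_⟩, rfl⟩
  · simp [planeOpen]
  · refine ⟨fun _ => ![1, 0], fun _ => ![0, 3], ?_, ?_⟩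
    · ext i j k
      fin_cases i <;> fin_cases j <;> fin_cases k <;> simp [hypermatrix, tangentialHypermatrix]
    · simp [wedge]

theorem nonempty_rhoPiFiber_iso_planeTimesPlane {a : BaseCoord → ℂ}
    (ha : a ∈ discriminantOpen \ hyperdeterminantalLocus) :
    Nonempty (rhoPiFiber a ≅ planeTimesPlane) := by
  obtain ⟨x, hx, rfl⟩ := exists_eq_sexticCover ha.1
  obtain ⟨c, d, hcd, h⟩ := exists_eq_decomposableHypermatrix (p := hypermatrix x)
    fun h0 => ha.2 ⟨x, ⟨hx, h0⟩, rfl⟩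
  obtain ⟨e⟩ := nonempty_rhoPiFiber_iso_trilinear hx
  rw [hcd] at e
  obtain ⟨e'⟩ := nonempty_trilinear_iso_segre h
  obtain ⟨e''⟩ := nonempty_segre_iso
  exact ⟨e ≪≫ e' ≪≫ e''⟩

theorem nonempty_rhoPiFiber_iso_degenerateDelPezzo {a : BaseCoord → ℂ}
    (ha : a ∈ tangentialLocus) : Nonempty (rhoPiFiber a ≅ degenerateDelPezzo) := by
  obtain ⟨x, ⟨hx, c, d, hcd, h⟩, rfl⟩ := ha
  obtain ⟨e⟩ := nonempty_rhoPiFiber_iso_trilinear hx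
  rw [hcd] at e
  obtain ⟨e'⟩ := nonempty_trilinear_iso_degenerateDelPezzo h
  exact ⟨e ≪≫ e'⟩

end KeyVariety

theorem proposition10p1 :
    (∀ a ∈ KeyVariety.discriminantOpen \ KeyVariety.hyperdeterminantalLocus,
      Nonempty (KeyVariety.rhoPiFiber a ≅ KeyVariety.planeTimesPlane)) ∧
    (∃ Z ⊆ KeyVariety.hyperdeterminantalLocus, Z.Nonempty ∧
      ∀ a ∈ Z, Nonempty (KeyVariety.rhoPiFiber a ≅ KeyVariety.degenerateDelPezzo)) :=
  ⟨fun _ => KeyVariety.nonempty_rhoPiFiber_iso_planeTimesPlane, KeyVariety.tangentialLocus,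
    KeyVariety.tangentialLocus_subset, KeyVariety.tangentialLocus_nonempty,
    fun _ => KeyVariety.nonempty_rhoPiFiber_iso_degenerateDelPezzo⟩
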